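/- Let $M$ be a connected smooth manifold (Hausdorff, second countable), $h$ a smooth Riemannian metric and $\omega$ a smooth 1-form on $M$, and $\alpha:\mathbb R\to(0,\infty)$ a smooth function. On $V=\mathbb R\times M$, time-oriented by $\partial_t$, consider the Lorentzian metrics $$g_{cl}=-dt^2+\omega\otimes dt+dt\otimes\omega+h,\qquad g_{op}=-dt^2+\alpha(t)\,\omega\otimes dt+\alpha(t)\,dt\otimes\omega+\alpha(t)^2h,$$ and let $g=-dt^2+\omega_t\otimes dt+dt\otimes\omega_t+h_t$ be a smooth Lorentzian metric on $V$, with $\omega_t$ a 1-form and $h_t$ a symmetric 2-tensor on $M$ depending smoothly on $(t,x)$. Assume $g_{cl}\prec_0 g\prec_0 g_{op}$, where $g\prec_0 g'$ means that every future-directed causal vector of $g$ is future-directed causal for $g'$. Assume also that $1/\alpha-1$ is integrable on $(0,\infty)$, i.e. $$\int_0^\infty\Big(\frac1{\alpha(s)}-1\Big)ds<\infty$$ (the cone comparison forces $\alpha\le1$ when $\dim M\ge1$). Let $I^-_{cl}$, $I^-_{op}$ denote the chronological pasts for $g_{cl}$, $g_{op}$ (defined by smooth future-directed timelike curves). An indecomposable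 past set (IP) of $g_{cl}$ is a non-empty set $P$ with $P=I^-_{cl}(P)$ that is not the union of two proper subsets with the same properties (non-empty, equal to their own past). Let $F^+(v)=\sqrt{h(v,v)+\omega(v)^2}+\omega(v)$, and let $d^+(x,y)$ be the infimum of the $F^+$-lengths of the piecewise smooth curves from $x$ to $y$. For $\tilde\alpha=1$ (subscript $cl$) or $\tilde\alpha=\alpha$ (subscript $op$), and for a smooth curve $c:[a,\Omega)\to M$, $a<\Omega\le\infty$, with $F^+(\dot c(t))<1/\tilde\alpha(t)$ for all $t$, the forward Busemann function of $c$ is $$b^+_{c,\tilde\alpha}(x)=\lim_{t\to\Omega}\Big(\int_0^t\frac{ds}{\tilde\alpha(s)}-d^+(x,c(t))\Big).$$ Let $B^+_{\tilde\alpha}(M)$ be the set of all finite forward Busemann functions, and for a function $f$ on $M$ put $P_{\tilde\alpha}(f)=\{(t_0,x_0)\in V:\int_0^{t_0}ds/\tilde\alpha(s)<f(x_0)\}$. Then: (1) If $b^+_{c,cl}\in B^+_{cl}(M)$ is the Busemann function of a curve $c:[a,\Omega)\to M$, $P_{cl}=P_{cl}(b^+_{c,cl})$, and $K_\Omega=\int_0^\Omega\big(\frac1{\alpha(s)}-1\big)ds$,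 then $b^+_{c,cl}+K_\Omega\in B^+_{op}(M)$ and $I^-_{op}(P_{cl})=P_{op}(b^+_{c,cl}+K_\Omega)$. (2) Let $P^1_{cl}$, $P^2_{cl}$ be IPs of $g_{cl}$. If $P^1_{cl}\subsetneq P^2_{cl}$, then $I^-_{op}(P^1_{cl})\subsetneq I^-_{op}(P^2_{cl})$; and if $P^1_{cl}\ne P^2_{cl}$, then $I^-_{op}(P^1_{cl})\ne I^-_{op}(P^2_{cl})$. -/

import Mathlib

open Set Filter Topology MeasureTheory Bundle Manifold
open scoped ContDiff

noncomputable section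

namespace Isocausal

section Smoothness

variable {n : ℕ} {M : Type*} [TopologicalSpace M] [ChartedSpace (EuclideanSpace ℝ (Fin n)) M]

/-- The model with corners of the manifold `ℝ × M`. -/
abbrev prodModel (n : ℕ) := (𝓘(ℝ, ℝ)).prod (𝓡 n)

theorem contMDiff_smul_along {F : Type*} [NormedAddCommGroup F] [NormedSpace ℝ F]
    {E : M → Type*} [∀ x, AddCommGroup (E x)] [∀ x, Module ℝ (E x)]
    [∀ x, TopologicalSpace (E x)] [TopologicalSpace (TotalSpace F E)]
    [FiberBundle F E] [VectorBundle ℝ F E]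
    {f : ℝ × M → ℝ} (hf : ContMDiff (prodModel n) 𝓘(ℝ, ℝ) ∞ f) {s : ∀ x : M, E x}
    (hs : ContMDiff (𝓡 n) ((𝓡 n).prod 𝓘(ℝ, F)) ∞ (fun x => TotalSpace.mk' F x (s x))) :
    ContMDiff (prodModel n) ((𝓡 n).prod 𝓘(ℝ, F)) ∞
      (fun p : ℝ × M => TotalSpace.mk' F p.2 (f p • s p.2)) := by
  intro p₀
  have hs' : ContMDiffAt (prodModel n) ((𝓡 n).prod 𝓘(ℝ, F)) ∞
      (fun p : ℝ × M => TotalSpace.mk' F p.2 (s p.2)) p₀ :=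
    (hs.comp contMDiff_snd) p₀
  rw [contMDiffAt_totalSpace] at hs' ⊢
  refine ⟨hs'.1, ((hf p₀).smul hs'.2).congr_of_eventuallyEq ?_⟩
  have hb : ∀ᶠ p : ℝ × M in 𝓝 p₀, p.2 ∈ (trivializationAt F E p₀.2).baseSet :=
    continuous_snd.continuousAt.eventually
      ((trivializationAt F E p₀.2).open_baseSet.mem_nhds (mem_baseSet_trivializationAt F E p₀.2))
  filter_upwards [hb] with p hp
  exact ((trivializationAt F E p₀.2).linear ℝ hp).2 (f p) (s p.2)

end Smoothness

section Metrics

variable {n : ℕ} {M : Type*} [TopologicalSpace M] [ChartedSpace (EuclideanSpace ℝ (Fin n)) M]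
  [IsManifold (𝓡 n) ∞ M]

/-- The space of linear forms on the tangent space of `M` at `x`. -/
abbrev Covector (n : ℕ) {M : Type*} [TopologicalSpace M]
    [ChartedSpace (EuclideanSpace ℝ (Fin n)) M] [IsManifold (𝓡 n) ∞ M] (x : M) : Type :=
  TangentSpace (𝓡 n) x →L[ℝ] ℝ

/-- The space of bilinear forms on the tangent space of `M` at `x`. -/
abbrev BilinForm (n : ℕ) {M : Type*} [TopologicalSpace M]
    [ChartedSpace (EuclideanSpace ℝ (Fin n)) M] [IsManifold (𝓡 n) ∞ M] (x : M) : Type :=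
  TangentSpace (𝓡 n) x →L[ℝ] TangentSpace (𝓡 n) x →L[ℝ] ℝ

variable (n M) in
/-- A (smooth) Riemannian metric on `M`. -/
abbrev RiemMetric := ContMDiffRiemannianMetric (𝓡 n) ∞ (EuclideanSpace ℝ (Fin n))
  (fun x : M => TangentSpace (𝓡 n) x)

variable (n M) in
/-- A smooth 1-form on `M`. -/
structure OneForm where
  toFun : ∀ x : M, Covector n x
  contMDiff : ContMDiff (𝓡 n) ((𝓡 n).prod 𝓘(ℝ, EuclideanSpace ℝ (Fin n) →L[ℝ] ℝ)) ∞
    (fun x : M => TotalSpace.mk' (EuclideanSpace ℝ (Fin n) →L[ℝ] ℝ)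
      (E := fun x : M => Covector n x) x (toFun x))

/-- The tangent space of `ℝ × M` at `p`; its elements are pairs `(τ, v)`, standing for
`τ ∂_t + v` with `v` tangent to `M`. -/
abbrev TangentV (n : ℕ) {M : Type*} [TopologicalSpace M]
    [ChartedSpace (EuclideanSpace ℝ (Fin n)) M] [IsManifold (𝓡 n) ∞ M] (p : ℝ × M) : Type :=
  TangentSpace (prodModel n) p

/-- The time component of a tangent vector of `ℝ × M`. -/
def timePart {p : ℝ × M} (u : TangentV n p) : ℝ :=
  (show ℝ × EuclideanSpace ℝ (Fin n) from u).1

/-- The component tangent to `M` of a tangent vector of `ℝ × M`. -/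
def spacePart {p : ℝ × M} (u : TangentV n p) : TangentSpace (𝓡 n) p.2 :=
  (show ℝ × EuclideanSpace ℝ (Fin n) from u).2

/-- The coordinate vector field `∂_t`. -/
def dt (p : ℝ × M) : TangentV n p :=
  (show ℝ × EuclideanSpace ℝ (Fin n) from (1, 0))

/-- The bilinear form `-dt² + θ ⊗ dt + dt ⊗ θ + h` on a tangent space of `ℝ × M`. -/
def splitForm {p : ℝ × M} (θ : Covector n p.2) (h : BilinForm n p.2) (u w : TangentV n p) : ℝ :=
  -(timePart u * timePart w) + θ (spacePart u) * timePart w + timePart u * θ (spacePart w)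
    + h (spacePart u) (spacePart w)

/-- Signature `(-, +, …, +)` of a symmetric bilinear form `B`: there is a vector `u` with
`B(u, u) < 0` such that `B` is positive definite on the orthogonal complement of `u`. -/
def IsLorentzian {p : ℝ × M} (B : TangentV n p → TangentV n p → ℝ) : Prop :=
  ∃ u, B u u < 0 ∧ ∀ w, B u w = 0 → w ≠ 0 → 0 < B w w

variable (n M) in
/-- A smooth Lorentzian metric `-dt² + θ_t ⊗ dt + dt ⊗ θ_t + h_t` on `ℝ × M`; the 1-form `θ_t` and
the symmetric tensor `h_t` on `M` depend smoothly on `(t, x)`.  It is time-oriented by `∂_t`. -/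
structure SplitMetric where
  θ : ∀ p : ℝ × M, Covector n p.2
  h : ∀ p : ℝ × M, BilinForm n p.2
  h_symm : ∀ (p : ℝ × M) (v w : TangentSpace (𝓡 n) p.2), h p v w = h p w v
  contMDiff_theta : ContMDiff (prodModel n) ((𝓡 n).prod 𝓘(ℝ, EuclideanSpace ℝ (Fin n) →L[ℝ] ℝ)) ∞
    (fun p : ℝ × M => TotalSpace.mk' (EuclideanSpace ℝ (Fin n) →L[ℝ] ℝ)
      (E := fun x : M => Covector n x) p.2 (θ p))
  contMDiff_h : ContMDiff (prodModel n)
    ((𝓡 n).prod 𝓘(ℝ, EuclideanSpace ℝ (Fin n) →L[ℝ] EuclideanSpace ℝ (Fin n) →L[ℝ] ℝ)) ∞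
    (fun p : ℝ × M => TotalSpace.mk'
      (EuclideanSpace ℝ (Fin n) →L[ℝ] EuclideanSpace ℝ (Fin n) →L[ℝ] ℝ)
      (E := fun x : M => BilinForm n x) p.2 (h p))
  lorentzian : ∀ p : ℝ × M, IsLorentzian (splitForm (θ p) (h p))

/-- The metric tensor of a `SplitMetric`. -/
def SplitMetric.form (g : SplitMetric n M) (p : ℝ × M) (u w : TangentV n p) : ℝ :=
  splitForm (g.θ p) (g.h p) u w

theorem isLorentzian_splitForm {p : ℝ × M} (θ : Covector n p.2) (h : BilinForm n p.2)
    (hpos : ∀ v, v ≠ 0 → 0 < h v v) : IsLorentzian (splitForm θ h) := by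
  have h1 : timePart (dt (n := n) p) = 1 := rfl
  have h2 : spacePart (dt (n := n) p) = 0 := rfl
  have h3 : ∀ v, h 0 v = 0 := fun v => DFunLike.congr_fun h.map_zero v
  refine ⟨dt p, ?_, ?_⟩
  · rw [splitForm, h1, h2, h3, θ.map_zero]
    norm_num
  · intro w hw hne
    have hw' : -timePart w + θ (spacePart w) = 0 := by
      rw [splitForm, h1, h2, h3, θ.map_zero] at hw
      linarith
    have hsp : spacePart w ≠ 0 := by
      intro h0
      apply hne
      have ht : timePart w = 0 := by
        rw [h0, θ.map_zero] at hw'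
        linarith
      exact Prod.ext ht h0
    have hh := hpos _ hsp
    rw [splitForm]
    nlinarith [mul_self_nonneg (θ (spacePart w))]

set_option synthInstance.maxHeartbeats 400000 in
set_option maxHeartbeats 1000000 in
/-- For a Riemannian metric `h`, a 1-form `θ` and a smooth positive function `α` of `t`, the metric
`g_α = -dt² + α(t) θ ⊗ dt + α(t) dt ⊗ θ + α(t)² h` on `ℝ × M`. -/
def warpedMetric (h : RiemMetric n M) (θ : OneForm n M) (α : ℝ → ℝ) (hα : ContDiff ℝ ∞ α)
    (hpos : ∀ t, 0 < α t) : SplitMetric n M where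
  θ p := α p.1 • θ.toFun p.2
  h p := α p.1 ^ 2 • h.inner p.2
  h_symm p v w := by
    change α p.1 ^ 2 * h.inner p.2 v w = α p.1 ^ 2 * h.inner p.2 w v
    rw [h.symm]
  contMDiff_theta := contMDiff_smul_along (F := EuclideanSpace ℝ (Fin n) →L[ℝ] ℝ)
    (E := fun x : M => Covector n x) (hα.contMDiff.comp contMDiff_fst) θ.contMDiff
  contMDiff_h := contMDiff_smul_along
    (F := EuclideanSpace ℝ (Fin n) →L[ℝ] EuclideanSpace ℝ (Fin n) →L[ℝ] ℝ)
    (E := fun x : M => BilinForm n x) ((hα.pow 2).contMDiff.comp contMDiff_fst) h.contMDiff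
  lorentzian p := isLorentzian_splitForm _ _ fun v hv =>
    mul_pos (pow_pos (hpos p.1) 2) (h.pos p.2 v hv)

/-- The metric `g_cl = -dt² + θ ⊗ dt + dt ⊗ θ + h`, i.e. `g_α` with `α = 1`. -/
def closedMetric (h : RiemMetric n M) (θ : OneForm n M) : SplitMetric n M :=
  warpedMetric h θ (fun _ => 1) contDiff_const (fun _ => one_pos)

end Metrics

section Causality

variable {n : ℕ} {M : Type*} [TopologicalSpace M] [ChartedSpace (EuclideanSpace ℝ (Fin n)) M]
  [IsManifold (𝓡 n) ∞ M]

/-- Future-directed causal vectors (the time orientation is given by `∂_t`). -/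
def FutureCausal (g : SplitMetric n M) (p : ℝ × M) (u : TangentV n p) : Prop :=
  u ≠ 0 ∧ g.form p u u ≤ 0 ∧ g.form p u (dt p) < 0

/-- Future-directed timelike vectors (the time orientation is given by `∂_t`). -/
def FutureTimelike (g : SplitMetric n M) (p : ℝ × M) (u : TangentV n p) : Prop :=
  g.form p u u < 0 ∧ g.form p u (dt p) < 0

/-- `g ≺₀ g'`: the identity is a causal mapping from `(ℝ × M, g)` to `(ℝ × M, g')`. -/
def ConesWiden (g g' : SplitMetric n M) : Prop :=
  ∀ (p : ℝ × M) (u : TangentV n p), FutureCausal g p u → FutureCausal g' p u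

/-- `γ : [a, b] → ℝ × M` is a smooth future-directed timelike curve. -/
def IsTimelikeCurve (g : SplitMetric n M) (a b : ℝ) (γ : ℝ → ℝ × M) : Prop :=
  ContMDiffOn 𝓘(ℝ, ℝ) (prodModel n) ∞ γ (Icc a b) ∧
  ∀ s ∈ Icc a b, FutureTimelike g (γ s)
    (mfderivWithin 𝓘(ℝ, ℝ) (prodModel n) γ (Icc a b) s (1 : ℝ))

/-- The chronological relation `p ≪ q` of the metric `g`. -/
def Chron (g : SplitMetric n M) (p q : ℝ × M) : Prop :=
  ∃ (a b : ℝ) (γ : ℝ → ℝ × M), a < b ∧ IsTimelikeCurve g a b γ ∧ γ a = p ∧ γ b = q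

/-- The chronological past `I⁻(S)` of a set. -/
def chronPast (g : SplitMetric n M) (S : Set (ℝ × M)) : Set (ℝ × M) :=
  {p | ∃ q ∈ S, Chron g p q}

/-- Past sets: the non-empty sets that coincide with their chronological past. -/
def IsPastSet (g : SplitMetric n M) (P : Set (ℝ × M)) : Prop :=
  P.Nonempty ∧ chronPast g P = P

/-- Indecomposable past sets: past sets that are not the union of two proper past subsets. -/
def IsIP (g : SplitMetric n M) (P : Set (ℝ × M)) : Prop :=
  IsPastSet g P ∧
  ¬ ∃ P₁ P₂, IsPastSet g P₁ ∧ IsPastSet g P₂ ∧ P₁ ⊂ P ∧ P₂ ⊂ P ∧ P = P₁ ∪ P₂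

end Causality

section Finsler

variable {n : ℕ} {M : Type*} [TopologicalSpace M] [ChartedSpace (EuclideanSpace ℝ (Fin n)) M]
  [IsManifold (𝓡 n) ∞ M]

/-- The Randers metric `F⁺(v) = √(h(v, v) + θ(v)²) + θ(v)`. -/
def randers (h : RiemMetric n M) (θ : OneForm n M) (x : M) (v : TangentSpace (𝓡 n) x) : ℝ :=
  Real.sqrt (h.inner x v v + θ.toFun x v ^ 2) + θ.toFun x v

variable (n) in
/-- `c : [a, b] → M` is piecewise smooth: smooth on each interval of some finite subdivision. -/
def PiecewiseSmooth (a b : ℝ) (c : ℝ → M) : Prop :=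
  ∃ (k : ℕ) (s : ℕ → ℝ), s 0 = a ∧ s k = b ∧ (∀ i < k, s i < s (i + 1)) ∧
    ∀ i < k, ContMDiffOn 𝓘(ℝ, ℝ) (𝓡 n) ∞ c (Icc (s i) (s (i + 1)))

/-- The `F⁺`-length of a piecewise smooth curve on `[a, b]`.  (The velocity is only undefined at the
finitely many break points and at the end points, which do not matter for the integral.) -/
def finslerLength (h : RiemMetric n M) (θ : OneForm n M) (a b : ℝ) (c : ℝ → M) : ℝ :=
  ∫ s in a..b, randers h θ (c s) (mfderiv 𝓘(ℝ, ℝ) (𝓡 n) c s (1 : ℝ))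

/-- The generalized distance `d⁺(x, y)`: the infimum of the `F⁺`-lengths of the piecewise smooth
curves from `x` to `y`. -/
def finslerDist (h : RiemMetric n M) (θ : OneForm n M) (x y : M) : ℝ :=
  sInf {L | ∃ (a b : ℝ) (c : ℝ → M), a ≤ b ∧ PiecewiseSmooth n a b c ∧ c a = x ∧ c b = y ∧
    L = finslerLength h θ a b c}

/-- The interval `[a, Ω)`, where `Ω ≤ ∞`. -/
def timeInterval (a : ℝ) (Ω : WithTop ℝ) : Set ℝ := {t | a ≤ t ∧ (t : WithTop ℝ) < Ω}

/-- The filter of `t → Ω` from below, where `Ω ≤ ∞`. -/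
def toEnd : WithTop ℝ → Filter ℝ
  | ⊤ => atTop
  | (r : ℝ) => 𝓝[<] r

/-- The curves `c : [a, Ω) → M` to which a Busemann function for `g_α` is associated: smooth
with `F⁺(ċ(t)) < 1/α(t)`, i.e. such that `t ↦ (t, c(t))` is future-directed timelike for `g_α`. -/
def IsBusemannCurve (h : RiemMetric n M) (θ : OneForm n M) (α : ℝ → ℝ) (a : ℝ) (Ω : WithTop ℝ)
    (c : ℝ → M) : Prop :=
  (a : WithTop ℝ) < Ω ∧
  ContMDiffOn 𝓘(ℝ, ℝ) (𝓡 n) ∞ c (timeInterval a Ω) ∧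
  ∀ t ∈ timeInterval a Ω,
    randers h θ (c t) (mfderivWithin 𝓘(ℝ, ℝ) (𝓡 n) c (timeInterval a Ω) t (1 : ℝ)) < 1 / α t

/-- `b` is the forward Busemann function `b⁺_{c,α}` of the curve `c : [a, Ω) → M`, which is finite:
`b(x) = lim_{t → Ω} (∫₀ᵗ ds/α(s) - d⁺(x, c(t)))`. -/
def IsBusemannOf (h : RiemMetric n M) (θ : OneForm n M) (α : ℝ → ℝ) (Ω : WithTop ℝ)
    (c : ℝ → M) (b : M → ℝ) : Prop :=
  ∀ x, Tendsto (fun t => (∫ s in (0 : ℝ)..t, 1 / α s) - finslerDist h θ x (c t)) (toEnd Ω)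
    (𝓝 (b x))

/-- The set `B⁺_α(M)` of all finite forward Busemann functions for `g_α`. -/
def busemannFunctions (h : RiemMetric n M) (θ : OneForm n M) (α : ℝ → ℝ) : Set (M → ℝ) :=
  {b | ∃ (a : ℝ) (Ω : WithTop ℝ) (c : ℝ → M),
    IsBusemannCurve h θ α a Ω c ∧ IsBusemannOf h θ α Ω c b}

/-- The set `P_α(f) = {(t₀, x₀) | ∫₀^{t₀} ds/α(s) < f(x₀)}`. -/
def pastOf (α : ℝ → ℝ) (f : M → ℝ) : Set (ℝ × M) :=
  {p | (∫ s in (0 : ℝ)..p.1, 1 / α s) < f p.2}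

/-- `K_Ω = ∫₀^Ω (1/α(s) - 1) ds`, where `Ω ≤ ∞`. -/
def shiftConst (α : ℝ → ℝ) : WithTop ℝ → ℝ
  | ⊤ => ∫ s in Ioi (0 : ℝ), (1 / α s - 1)
  | (r : ℝ) => ∫ s in (0 : ℝ)..r, (1 / α s - 1)

end Finsler

end Isocausal

end

/-! Dividing the metric by `α²` shows that `(τ, v)` is future timelike for `g_α` iff `F⁺(v) < τ/α`.
With the conformal time `T(t) = ∫₀ᵗ ds/α` this integrates to: `p ≪ q` for `g_α` iff `d⁺(p.2, q.2) <
T(q.1) - T(p.1)` (`chron_warpedMetric_iff`). So both chronologies come from the same `d⁺` and differ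
only in the clock, `t` for `g_cl` and `T` for `g_op`.

For (1), `T(t) - d⁺(x, c(t))` increases along a Busemann curve by the triangle inequality, so the
sublevel set of the limit is the past of the graph (`pastOf_eq_chronPast`). Changing the clock adds
`T(t) - t → K_Ω`, and passing through the `g_cl`-past first does not change the `g_op`-past of the
graph.

For (2), an IP is directed under `≪` (`IsIP.directed`), so no generating curve is needed. Since `α ≤
1` and `1/α - 1` is integrable, `T(t) - t` is monotone and bounded above. Let `Cᵢ` be its supremum
over `Pᵢ`. High up in `P₂` the two clocks differ by almost `C₂`, in `P₁` by at most `C₁`; if `C₁ ≤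
C₂`, an inclusion of the `g_op`-past of `P₂` in that of `P₁` therefore descends to `P₂ ⊆ P₁`
(`IsIP.subset_of_chronPast_subset`). Applied twice, this gives injectivity; strict inclusion follows
by monotonicity. If all tangent vectors vanish, `α ≤ 1` may fail, but then `d⁺ = 0` and the two
pasts coincide. -/

noncomputable section

namespace Isocausal

/-! ### Cones of the warped metrics in terms of the Randers metric -/

section Algebra

variable {n : ℕ} {M : Type*} [TopologicalSpace M] [ChartedSpace (EuclideanSpace ℝ (Fin n)) M]
  [IsManifold (𝓡 n) ∞ M]

theorem inner_self_nonneg (h : RiemMetric n M) (x : M) (v : TangentSpace (𝓡 n) x) :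
    0 ≤ h.inner x v v := by
  by_cases hv : v = 0
  · subst hv
    exact le_of_eq (DFunLike.congr_fun (h.inner x).map_zero 0).symm
  · exact (h.pos x v hv).le

theorem randers_nonneg (h : RiemMetric n M) (θ : OneForm n M) (x : M)
    (v : TangentSpace (𝓡 n) x) : 0 ≤ randers h θ x v := by
  have h1 : |θ.toFun x v| ≤ Real.sqrt (h.inner x v v + θ.toFun x v ^ 2) := by
    apply Real.abs_le_sqrt
    linarith [inner_self_nonneg h x v]
  unfold randers
  linarith [neg_abs_le (θ.toFun x v)]

theorem randers_zero (h : RiemMetric n M) (θ : OneForm n M) (x : M) :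
    randers h θ x 0 = 0 := by
  have h1 : h.inner x 0 (0 : TangentSpace (𝓡 n) x) = 0 :=
    DFunLike.congr_fun (h.inner x).map_zero 0
  have h2 : θ.toFun x (0 : TangentSpace (𝓡 n) x) = 0 := (θ.toFun x).map_zero
  rw [randers, h1, h2]
  norm_num

theorem randers_pos (h : RiemMetric n M) (θ : OneForm n M) (x : M)
    {v : TangentSpace (𝓡 n) x} (hv : v ≠ 0) : 0 < randers h θ x v := by
  have h1 : |θ.toFun x v| < Real.sqrt (h.inner x v v + θ.toFun x v ^ 2) := by
    rw [← Real.sqrt_sq_eq_abs]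
    apply Real.sqrt_lt_sqrt (sq_nonneg _)
    linarith [h.pos x v hv]
  unfold randers
  linarith [neg_abs_le (θ.toFun x v)]

theorem randers_smul (h : RiemMetric n M) (θ : OneForm n M) (x : M) {r : ℝ} (hr : 0 ≤ r)
    (v : TangentSpace (𝓡 n) x) : randers h θ x (r • v) = r * randers h θ x v := by
  have h1 : h.inner x (r • v) (r • v) = r ^ 2 * h.inner x v v := by
    have : h.inner x (r • v) = r • h.inner x v := (h.inner x).map_smul r v
    rw [this]
    have h3 : h.inner x v (r • v) = r • h.inner x v v := (h.inner x v).map_smul r v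
    change r * h.inner x v (r • v) = _
    rw [h3, smul_eq_mul]
    ring
  have h2 : θ.toFun x (r • v) = r * θ.toFun x v := (θ.toFun x).map_smul r v
  rw [randers, randers, h1, h2,
    show r ^ 2 * h.inner x v v + (r * θ.toFun x v) ^ 2
      = r ^ 2 * (h.inner x v v + θ.toFun x v ^ 2) by ring,
    Real.sqrt_mul (sq_nonneg r), Real.sqrt_sq hr]
  ring

variable {h : RiemMetric n M} {θ : OneForm n M} {α : ℝ → ℝ} {hα : ContDiff ℝ ∞ α}
  {hpos : ∀ t, 0 < α t}

theorem warpedMetric_form_self (p : ℝ × M) (u : TangentV n p) :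
    (warpedMetric h θ α hα hpos).form p u u =
      α p.1 ^ 2 * (h.inner p.2 (spacePart u) (spacePart u)
        + 2 * (timePart u / α p.1) * θ.toFun p.2 (spacePart u) - (timePart u / α p.1) ^ 2) := by
  have h0 := (hpos p.1).ne'
  change -(timePart u * timePart u) + α p.1 * θ.toFun p.2 (spacePart u) * timePart u
    + timePart u * (α p.1 * θ.toFun p.2 (spacePart u))
    + α p.1 ^ 2 * h.inner p.2 (spacePart u) (spacePart u) = _
  field_simp
  ring

theorem warpedMetric_form_dt (p : ℝ × M) (u : TangentV n p) :
    (warpedMetric h θ α hα hpos).form p u (dt p) =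
      α p.1 * (θ.toFun p.2 (spacePart u) - timePart u / α p.1) := by
  have h0 := (hpos p.1).ne'
  have h3 : θ.toFun p.2 (0 : TangentSpace (𝓡 n) p.2) = 0 := (θ.toFun p.2).map_zero
  have h4 : h.inner p.2 (spacePart u) (0 : TangentSpace (𝓡 n) p.2) = 0 :=
    (h.inner p.2 (spacePart u)).map_zero
  change -(timePart u * 1) + α p.1 * θ.toFun p.2 (spacePart u) * 1
    + timePart u * (α p.1 * θ.toFun p.2 (0 : TangentSpace (𝓡 n) p.2))
    + α p.1 ^ 2 * h.inner p.2 (spacePart u) (0 : TangentSpace (𝓡 n) p.2) = _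
  rw [h3, h4]
  field_simp
  ring

/-- With `s = τ/α`, `H = h(v, v)` and `w = θ(v)`, the form is `α²(H + 2sw - s²)`, which is negative
iff `H + w² < (s - w)²`; the time orientation says `s - w > 0`, so a square root may be taken. -/
theorem futureTimelike_warpedMetric_iff (p : ℝ × M) (u : TangentV n p) :
    FutureTimelike (warpedMetric h θ α hα hpos) p u ↔
      randers h θ p.2 (spacePart u) < timePart u / α p.1 := by
  have h0 := hpos p.1
  have hn := inner_self_nonneg h p.2 (spacePart u)
  rw [FutureTimelike, warpedMetric_form_self, warpedMetric_form_dt, randers]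
  generalize h.inner p.2 (spacePart u) (spacePart u) = H at *
  generalize θ.toFun p.2 (spacePart u) = w at *
  generalize timePart u / α p.1 = s at *
  have hpos2 : 0 < α p.1 ^ 2 := by positivity
  have key : ∀ {a b : ℝ}, 0 < a → (a * b < 0 ↔ b < 0) := fun {a b} ha =>
    ⟨fun hab => by
      by_contra hb
      exact absurd hab (not_lt.2 (mul_nonneg ha.le (not_lt.1 hb))), mul_neg_of_pos_of_neg ha⟩
  rw [key hpos2, key h0, ← lt_sub_iff_add_lt]
  constructor
  · rintro ⟨h1, h2⟩
    rw [Real.sqrt_lt' (by linarith)]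
    nlinarith
  · intro h1
    have h2 : 0 < s - w := lt_of_le_of_lt (Real.sqrt_nonneg _) h1
    rw [Real.sqrt_lt' h2] at h1
    constructor <;> nlinarith

theorem futureCausal_warpedMetric_iff (p : ℝ × M) (u : TangentV n p) (hu : spacePart u ≠ 0) :
    FutureCausal (warpedMetric h θ α hα hpos) p u ↔
      randers h θ p.2 (spacePart u) ≤ timePart u / α p.1 := by
  have h0 := hpos p.1
  have hn := h.pos p.2 (spacePart u) hu
  have hu' : u ≠ 0 := by
    rintro rfl
    exact hu rfl
  rw [FutureCausal, warpedMetric_form_self, warpedMetric_form_dt, randers]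
  generalize h.inner p.2 (spacePart u) (spacePart u) = H at *
  generalize θ.toFun p.2 (spacePart u) = w at *
  generalize timePart u / α p.1 = s at *
  have hpos2 : 0 < α p.1 ^ 2 := by positivity
  rw [← le_sub_iff_add_le]
  constructor
  · rintro ⟨-, h1, h2⟩
    have h1 := nonpos_of_mul_nonpos_right h1 hpos2
    have h2 : w - s < 0 := by
      by_contra hc
      exact absurd h2 (not_lt.2 (mul_nonneg h0.le (not_lt.1 hc)))
    rw [Real.sqrt_le_left (by linarith)]
    nlinarith
  · intro h1
    have h3 : 0 < Real.sqrt (H + w ^ 2) := Real.sqrt_pos.2 (by positivity)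
    have h2 : 0 < s - w := lt_of_lt_of_le h3 h1
    rw [Real.sqrt_le_left h2.le] at h1
    refine ⟨hu', ?_, ?_⟩
    · apply mul_nonpos_of_nonneg_of_nonpos hpos2.le
      nlinarith
    · apply mul_neg_of_pos_of_neg h0
      linarith

/-- The vector `(F⁺(v), v)` is lightlike for `g_cl`; its causality for `g_α` reads `F⁺(v) ≤
F⁺(v)/α`, and `F⁺(v) > 0`. -/
theorem le_one_of_conesWiden {x : M} {v : TangentSpace (𝓡 n) x} (hv : v ≠ 0)
    (hw : ConesWiden (closedMetric h θ) (warpedMetric h θ α hα hpos)) (t : ℝ) : α t ≤ 1 := by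
  let u : TangentV n ((t, x) : ℝ × M) :=
    (show ℝ × EuclideanSpace ℝ (Fin n) from (randers h θ x v, v))
  have h1 : FutureCausal (closedMetric h θ) ((t, x) : ℝ × M) u := by
    refine (futureCausal_warpedMetric_iff _ u hv).2 ?_
    change randers h θ x v ≤ randers h θ x v / 1
    rw [div_one]
  have h2 : randers h θ x v ≤ randers h θ x v / α t :=
    (futureCausal_warpedMetric_iff _ u hv).1 (hw _ u h1)
  rw [le_div_iff₀ (hpos t)] at h2
  nlinarith [randers_pos h θ x hv]

theorem randers_lt_div_of_conesWiden
    (hw : ConesWiden (closedMetric h θ) (warpedMetric h θ α hα hpos)) (t : ℝ) {x : M}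
    {v : TangentSpace (𝓡 n) x} {τ : ℝ} (hv : randers h θ x v < τ) :
    randers h θ x v < τ / α t := by
  by_cases h0 : v = 0
  · subst h0
    rw [randers_zero] at hv ⊢
    exact div_pos hv (hpos t)
  · refine hv.trans_le ?_
    rw [le_div_iff₀ (hpos t)]
    nlinarith [le_one_of_conesWiden h0 hw t, randers_nonneg h θ x v]

theorem chron_mono_of_conesWiden
    (hw : ConesWiden (closedMetric h θ) (warpedMetric h θ α hα hpos)) {p q : ℝ × M}
    (hpq : Chron (closedMetric h θ) p q) : Chron (warpedMetric h θ α hα hpos) p q := by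
  obtain ⟨a, b, γ, hab, ⟨hγ, ht⟩, rfl, rfl⟩ := hpq
  refine ⟨a, b, γ, hab, ⟨hγ, fun s hs => ?_⟩, rfl, rfl⟩
  rw [futureTimelike_warpedMetric_iff]
  apply randers_lt_div_of_conesWiden hw
  have := (futureTimelike_warpedMetric_iff _ _).1 (ht s hs)
  rwa [div_one] at this

end Algebra

/-! ### Continuity of the Finsler speed -/

section Speed

variable {n : ℕ} {M : Type*} [TopologicalSpace M] [ChartedSpace (EuclideanSpace ℝ (Fin n)) M]
  [IsManifold (𝓡 n) ∞ M]

/-- The `F⁺`-speed of `c` relative to the parameter set `S`. -/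
def speedWithin (h : RiemMetric n M) (θ : OneForm n M) (c : ℝ → M) (S : Set ℝ) (s : ℝ) : ℝ :=
  randers h θ (c s) (mfderivWithin 𝓘(ℝ, ℝ) (𝓡 n) c S s (1 : ℝ))

theorem continuousOn_speedWithin (h : RiemMetric n M) (θ : OneForm n M) {c : ℝ → M} {S : Set ℝ}
    (hS : UniqueDiffOn ℝ S) (hc : ContMDiffOn 𝓘(ℝ, ℝ) (𝓡 n) ∞ c S) :
    ContinuousOn (speedWithin h θ c S) S := by
  have hS' : UniqueMDiffOn 𝓘(ℝ, ℝ) S := hS.uniqueMDiffOn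
  have hv : ContMDiffOn 𝓘(ℝ, ℝ) ((𝓡 n).prod 𝓘(ℝ, EuclideanSpace ℝ (Fin n))) 0
      (fun s => TotalSpace.mk' (EuclideanSpace ℝ (Fin n))
        (E := fun x : M => TangentSpace (𝓡 n) x) (c s)
        (mfderivWithin 𝓘(ℝ, ℝ) (𝓡 n) c S s (1 : ℝ))) S := by
    have h1 := hc.contMDiffOn_tangentMapWithin (m := 0) (by simp) hS'
    have h2 : ContMDiffOn 𝓘(ℝ, ℝ) ((𝓘(ℝ, ℝ)).prod 𝓘(ℝ, ℝ)) 0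
        (fun s : ℝ => (⟨s, (1 : ℝ)⟩ : TangentBundle 𝓘(ℝ, ℝ) ℝ)) S := by
      intro s hs
      rw [contMDiffWithinAt_totalSpace]
      refine ⟨contMDiffWithinAt_id, ?_⟩
      simp only [trivializationAt_model_space_apply]
      exact contMDiffWithinAt_const
    exact h1.comp h2 (fun s hs => hs)
  have hinner : ContMDiffOn 𝓘(ℝ, ℝ) ((𝓡 n).prod 𝓘(ℝ, ℝ)) 0
      (fun s => TotalSpace.mk' ℝ (E := Bundle.Trivial M ℝ) (c s)
        (h.inner (c s) (mfderivWithin 𝓘(ℝ, ℝ) (𝓡 n) c S s (1 : ℝ))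
          (mfderivWithin 𝓘(ℝ, ℝ) (𝓡 n) c S s (1 : ℝ)))) S :=
    ContMDiffOn.clm_bundle_apply₂ (F₁ := EuclideanSpace ℝ (Fin n))
      (F₂ := EuclideanSpace ℝ (Fin n))
      (((h.contMDiff.of_le (by simp)).comp_contMDiffOn (hc.of_le (by simp)))) hv hv
  have hform : ContMDiffOn 𝓘(ℝ, ℝ) ((𝓡 n).prod 𝓘(ℝ, ℝ)) 0
      (fun s => TotalSpace.mk' ℝ (E := Bundle.Trivial M ℝ) (c s)
        (θ.toFun (c s) (mfderivWithin 𝓘(ℝ, ℝ) (𝓡 n) c S s (1 : ℝ)))) S :=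
    ContMDiffOn.clm_bundle_apply (F₁ := EuclideanSpace ℝ (Fin n))
      (((θ.contMDiff.of_le (by simp)).comp_contMDiffOn (hc.of_le (by simp)))) hv
  have hi : ContinuousOn (fun s => h.inner (c s) (mfderivWithin 𝓘(ℝ, ℝ) (𝓡 n) c S s (1 : ℝ))
          (mfderivWithin 𝓘(ℝ, ℝ) (𝓡 n) c S s (1 : ℝ))) S := by
    intro s hs
    have := hinner s hs
    rw [contMDiffWithinAt_totalSpace] at this
    exact this.2.continuousWithinAt
  have hf : ContinuousOn (fun s => θ.toFun (c s)
      (mfderivWithin 𝓘(ℝ, ℝ) (𝓡 n) c S s (1 : ℝ))) S := by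
    intro s hs
    have := hform s hs
    rw [contMDiffWithinAt_totalSpace] at this
    exact this.2.continuousWithinAt
  exact ((hi.add (hf.pow 2)).sqrt).add hf

end Speed

/-! ### Smooth curves with prescribed length: reparametrization and concatenation -/

section Links

variable {n : ℕ} {M : Type*} [TopologicalSpace M] [ChartedSpace (EuclideanSpace ℝ (Fin n)) M]
  [IsManifold (𝓡 n) ∞ M]

/-- The `F⁺`-speed of `c`. -/
def speed (h : RiemMetric n M) (θ : OneForm n M) (c : ℝ → M) (s : ℝ) : ℝ :=
  randers h θ (c s) (mfderiv 𝓘(ℝ, ℝ) (𝓡 n) c s (1 : ℝ))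

variable {h : RiemMetric n M} {θ : OneForm n M} {c c' : ℝ → M} {x y z : M} {s : ℝ}

theorem speed_nonneg (h : RiemMetric n M) (θ : OneForm n M) (c : ℝ → M) (s : ℝ) :
    0 ≤ speed h θ c s :=
  randers_nonneg h θ _ _

theorem speedWithin_univ : speedWithin h θ c univ = speed h θ c := by
  funext s
  rw [speedWithin, speed, mfderivWithin_univ]

theorem continuous_speed (hc : ContMDiff 𝓘(ℝ, ℝ) (𝓡 n) ∞ c) : Continuous (speed h θ c) := by
  rw [← continuousOn_univ, ← speedWithin_univ]
  exact continuousOn_speedWithin h θ uniqueDiffOn_univ (contMDiffOn_univ.2 hc)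

theorem speed_congr (hcc : c =ᶠ[𝓝 s] c') : speed h θ c s = speed h θ c' s := by
  have h1 := hcc.mfderiv_eq (I := 𝓘(ℝ, ℝ)) (I' := 𝓡 n)
  rw [speed, speed, h1]
  exact congrArg (fun x => randers h θ x
    (show EuclideanSpace ℝ (Fin n) from mfderiv 𝓘(ℝ, ℝ) (𝓡 n) c' s (1 : ℝ))) hcc.self_of_nhds

theorem speed_eq_zero (hcc : c =ᶠ[𝓝 s] fun _ => x) : speed h θ c s = 0 := by
  rw [speed_congr hcc, speed, mfderiv_const]
  exact randers_zero h θ x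

theorem speedWithin_eq_speed {S : Set ℝ} (hS : S ∈ 𝓝 s) :
    speedWithin h θ c S s = speed h θ c s := by
  rw [speedWithin, speed, mfderivWithin_of_mem_nhds hS]

/-- The sign condition on `ψ'` is needed because `F⁺` is only positively homogeneous. -/
theorem speed_comp {S : Set ℝ} (hc : ContMDiffOn 𝓘(ℝ, ℝ) (𝓡 n) ∞ c S) {ψ : ℝ → ℝ} {ψ' : ℝ}
    (hψ : HasDerivAt ψ ψ' s) (hψ0 : 0 ≤ ψ') (hmaps : ∀ r, ψ r ∈ S) :
    speed h θ (c ∘ ψ) s = speedWithin h θ c S (ψ s) * ψ' := by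
  have h1 := ((hc (ψ s) (hmaps s)).mdifferentiableWithinAt (by simp)).hasMFDerivWithinAt
  have h2 : HasMFDerivWithinAt 𝓘(ℝ, ℝ) 𝓘(ℝ, ℝ) ψ univ s
      (ContinuousLinearMap.toSpanSingleton ℝ ψ') :=
    hasMFDerivWithinAt_iff_hasFDerivWithinAt.2 hψ.hasFDerivAt.hasFDerivWithinAt
  have h3 := h1.comp s h2 (fun r _ => hmaps r)
  have h4 : mfderiv 𝓘(ℝ, ℝ) (𝓡 n) (c ∘ ψ) s (1 : ℝ)
      = ψ' • mfderivWithin 𝓘(ℝ, ℝ) (𝓡 n) c S (ψ s) (1 : ℝ) := by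
    rw [(hasMFDerivWithinAt_univ.1 h3).mfderiv]
    change mfderivWithin 𝓘(ℝ, ℝ) (𝓡 n) c S (ψ s) ((1 : ℝ) • ψ') = _
    rw [one_smul]
    refine Eq.trans ?_ ((mfderivWithin 𝓘(ℝ, ℝ) (𝓡 n) c S (ψ s)).map_smul ψ' (1 : ℝ))
    exact congrArg (mfderivWithin 𝓘(ℝ, ℝ) (𝓡 n) c S (ψ s)) (mul_one ψ').symm
  rw [speed, h4, mul_comm]
  exact randers_smul h θ _ hψ0 _

theorem finslerLength_eq_integral_speedWithin {p q : ℝ} (hpq : p ≤ q) :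
    finslerLength h θ p q c = ∫ s in p..q, speedWithin h θ c (Icc p q) s := by
  apply intervalIntegral.integral_congr_uIoo
  rw [uIoo_of_le hpq]
  intro s hs
  exact (speedWithin_eq_speed (Icc_mem_nhds hs.1 hs.2)).symm

theorem intervalIntegrable_speed {p q : ℝ} (hpq : p < q)
    (hc : ContMDiffOn 𝓘(ℝ, ℝ) (𝓡 n) ∞ c (Icc p q)) :
    IntervalIntegrable (speed h θ c) volume p q := by
  have h1 : IntervalIntegrable (speedWithin h θ c (Icc p q)) volume p q := by
    apply ContinuousOn.intervalIntegrable_of_Icc hpq.le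
    exact continuousOn_speedWithin h θ (uniqueDiffOn_Icc hpq) hc
  apply h1.congr_uIoo
  rw [uIoo_of_le hpq.le]
  intro s hs
  exact speedWithin_eq_speed (Icc_mem_nhds hs.1 hs.2)

variable (h θ) in
/-- `x` and `y` are joined by a smooth curve of `F⁺`-length `L`, parametrized by `ℝ` and
constant outside `[0, 1]`. -/
def SmoothLink (x y : M) (L : ℝ) : Prop :=
  ∃ c : ℝ → M, ContMDiff 𝓘(ℝ, ℝ) (𝓡 n) ∞ c ∧ (∀ s ≤ 0, c s = x) ∧ (∀ s ≥ 1, c s = y) ∧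
    ∫ s, speed h θ c s = L

theorem SmoothLink.refl (x : M) : SmoothLink h θ x x 0 := by
  refine ⟨fun _ => x, contMDiff_const, fun _ _ => rfl, fun _ _ => rfl, ?_⟩
  have : speed h θ (fun _ : ℝ => x) = fun _ => 0 := funext fun s => speed_eq_zero (by rfl)
  rw [this, integral_zero]

theorem support_speed_subset {a b : ℝ} (ha : ∀ s ≤ a, c s = x) (hb : ∀ s ≥ b, c s = y) :
    Function.support (speed h θ c) ⊆ Icc a b := by
  intro s hs
  by_contra hn
  rw [mem_Icc, not_and_or, not_le, not_le] at hn
  apply hs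
  rcases hn with hn | hn
  · exact speed_eq_zero (x := x) (eventuallyEq_of_mem (Iio_mem_nhds hn) fun r hr =>
      ha r (le_of_lt hr))
  · exact speed_eq_zero (x := y) (eventuallyEq_of_mem (Ioi_mem_nhds hn) fun r hr =>
      hb r (le_of_lt hr))

/-- The inequality `a' < a` is strict because interval integrals run over `Ioc a' b'` while the
support lies in the closed `Icc a b`. This is why later curves start at `-1` rather than `0`. -/
theorem integral_speed_eq_finslerLength {a b a' b' : ℝ} (ha : ∀ s ≤ a, c s = x)
    (hb : ∀ s ≥ b, c s = y) (haa : a' < a) (hbb : b ≤ b') :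
    finslerLength h θ a' b' c = ∫ s, speed h θ c s := by
  apply intervalIntegral.integral_eq_integral_of_support_subset
  exact (support_speed_subset ha hb).trans (fun s hs => ⟨haa.trans_le hs.1, hs.2.trans hbb⟩)

theorem integrable_speed {a b : ℝ} (hc : ContMDiff 𝓘(ℝ, ℝ) (𝓡 n) ∞ c) (ha : ∀ s ≤ a, c s = x)
    (hb : ∀ s ≥ b, c s = y) : Integrable (speed h θ c) := by
  apply (continuous_speed hc).integrable_of_hasCompactSupport
  exact HasCompactSupport.of_support_subset_isCompact isCompact_Icc (support_speed_subset ha hb)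

/-- Reparametrizing by a smooth step makes the curve rest at both ends without changing its length.
Resting curves can be glued smoothly, so corners of piecewise smooth curves disappear, as the smooth
curves in `Chron` require. -/
theorem SmoothLink.of_contMDiffOn {p q : ℝ} (hpq : p < q)
    (hc : ContMDiffOn 𝓘(ℝ, ℝ) (𝓡 n) ∞ c (Icc p q)) :
    SmoothLink h θ (c p) (c q) (finslerLength h θ p q c) := by
  set ψ : ℝ → ℝ := fun s => p + (q - p) * Real.smoothTransition s with hψ
  have hψs : ContDiff ℝ ∞ ψ :=
    contDiff_const.add (contDiff_const.mul Real.smoothTransition.contDiff)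
  have hmaps : ∀ r, ψ r ∈ Icc p q := by
    intro r
    have h0 := Real.smoothTransition.nonneg r
    have h1 := Real.smoothTransition.le_one r
    constructor <;> simp only [hψ] <;> nlinarith
  have hmono : Monotone ψ := by
    intro r s hrs
    have := Real.smoothTransition.monotone hrs
    simp only [hψ]
    nlinarith
  have hleft : ∀ s ≤ 0, ψ s = p := fun s hs => by
    simp [hψ, Real.smoothTransition.zero_of_nonpos hs]
  have hright : ∀ s ≥ 1, ψ s = q := fun s hs => by
    simp [hψ, Real.smoothTransition.one_of_one_le hs]
  have hl : ∀ s ≤ 0, (c ∘ ψ) s = c p := fun s hs => congrArg c (hleft s hs)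
  have hr : ∀ s ≥ 1, (c ∘ ψ) s = c q := fun s hs => congrArg c (hright s hs)
  refine ⟨c ∘ ψ, ?_, hl, hr, ?_⟩
  · exact contMDiffOn_univ.1 (hc.comp hψs.contMDiff.contMDiffOn fun r _ => hmaps r)
  · have hd : ∀ s, HasDerivAt ψ (deriv ψ s) s := fun s =>
      (hψs.differentiable (by simp) s).hasDerivAt
    rw [← integral_speed_eq_finslerLength hl hr (show (-1 : ℝ) < 0 by norm_num) le_rfl,
      finslerLength_eq_integral_speedWithin hpq.le]
    have key : ∫ s in (-1 : ℝ)..1, (speedWithin h θ c (Icc p q) ∘ ψ) s * deriv ψ s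
        = ∫ u in ψ (-1)..ψ 1, speedWithin h θ c (Icc p q) u := by
      apply intervalIntegral.integral_comp_mul_deriv''
      · exact hψs.continuous.continuousOn
      · exact fun s _ => (hd s).hasDerivWithinAt
      · exact (hψs.continuous_deriv (by simp)).continuousOn
      · apply (continuousOn_speedWithin h θ (uniqueDiffOn_Icc hpq) hc).mono
        rintro _ ⟨r, -, rfl⟩
        exact hmaps r
    rw [hleft _ (by norm_num), hright _ le_rfl] at key
    rw [← key]
    apply intervalIntegral.integral_congr
    intro s _
    exact speed_comp hc (hd s) (hmono.deriv_nonneg) hmaps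

theorem SmoothLink.trans {L₁ L₂ : ℝ} (h₁ : SmoothLink h θ x y L₁) (h₂ : SmoothLink h θ y z L₂) :
    SmoothLink h θ x z (L₁ + L₂) := by
  obtain ⟨c₁, hc₁, hl₁, hr₁, rfl⟩ := h₁
  obtain ⟨c₂, hc₂, hl₂, hr₂, rfl⟩ := h₂
  set e : ℝ → M := c₂ ∘ fun s => s - 2 with he
  have hes : ContMDiff 𝓘(ℝ, ℝ) (𝓡 n) ∞ e :=
    hc₂.comp (contDiff_id.sub contDiff_const).contMDiff
  have hle : ∀ s ≤ 2, e s = y := fun s hs => hl₂ _ (by linarith)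
  have hre : ∀ s ≥ 3, e s = z := fun s hs => hr₂ _ (by linarith)
  have hspeed : ∀ s, speed h θ e s = speed h θ c₂ (s - 2) := by
    intro s
    have := speed_comp (h := h) (θ := θ) (s := s) (contMDiffOn_univ.2 hc₂)
      ((hasDerivAt_id s).sub_const 2) zero_le_one (fun _ => mem_univ _)
    rw [speedWithin_univ, mul_one] at this
    exact this
  -- Both curves rest at `y` on `[1, 2]`, so the switch at `3/2` is invisible: `f` agrees with `c₁`
  -- before `2` and with `e` after `1`.
  set f : ℝ → M := fun s => if s < 3 / 2 then c₁ s else e s with hf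
  have hf₁ : ∀ s < 2, f s = c₁ s := by
    intro s hs
    by_cases h1 : s < 3 / 2
    · simp [hf, h1]
    · simp only [hf, h1, if_false]
      rw [hle s hs.le, hr₁ s (by linarith)]
  have hf₂ : ∀ s > 1, f s = e s := by
    intro s hs
    by_cases h1 : s < 3 / 2
    · simp only [hf, h1, if_true]
      rw [hle s (by linarith), hr₁ s (by linarith)]
    · simp [hf, h1]
  have hn₁ : ∀ s < 2, f =ᶠ[𝓝 s] c₁ := fun s hs =>
    eventuallyEq_of_mem (Iio_mem_nhds hs) fun r hr => hf₁ r hr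
  have hn₂ : ∀ s > 1, f =ᶠ[𝓝 s] e := fun s hs =>
    eventuallyEq_of_mem (Ioi_mem_nhds hs) fun r hr => hf₂ r hr
  have hfs : ContMDiff 𝓘(ℝ, ℝ) (𝓡 n) ∞ f := by
    intro s
    rcases lt_or_ge s 2 with hs | hs
    · exact (hc₁ s).congr_of_eventuallyEq (hn₁ s hs)
    · exact (hes s).congr_of_eventuallyEq (hn₂ s (by linarith))
  have hlf : ∀ s ≤ 0, f s = x := fun s hs => by rw [hf₁ s (by linarith), hl₁ s hs]
  have hrf : ∀ s ≥ 3, f s = z := fun s hs => by rw [hf₂ s (by linarith), hre s hs]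
  have hsum : ∀ s, speed h θ f s = speed h θ c₁ s + speed h θ e s := by
    intro s
    rcases lt_or_ge s 2 with hs | hs
    · rw [speed_congr (hn₁ s hs), speed_eq_zero (c := e) (x := y)
        (eventuallyEq_of_mem (Iio_mem_nhds hs) fun r hr => hle r (le_of_lt hr)), add_zero]
    · rw [speed_congr (hn₂ s (by linarith)), speed_eq_zero (c := c₁) (x := y)
        (eventuallyEq_of_mem (Ioi_mem_nhds (show 1 < s by linarith)) fun r hr =>
          hr₁ r (le_of_lt hr)), zero_add]
  have hlink := SmoothLink.of_contMDiffOn (h := h) (θ := θ) (show (-1 : ℝ) < 3 by norm_num)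
    hfs.contMDiffOn
  rw [integral_speed_eq_finslerLength hlf hrf (by norm_num) le_rfl, hlf _ (by norm_num),
    hrf _ le_rfl] at hlink
  convert hlink using 1
  simp_rw [hsum]
  rw [integral_add (integrable_speed hc₁ hl₁ hr₁) (integrable_speed hes hle hre)]
  simp_rw [hspeed]
  rw [integral_sub_right_eq_self (speed h θ c₂)]

theorem SmoothLink.of_piecewiseSmooth {a b : ℝ} (hc : PiecewiseSmooth n a b c) :
    SmoothLink h θ (c a) (c b) (finslerLength h θ a b c) := by
  obtain ⟨k, s, rfl, rfl, hs, hsm⟩ := hc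
  -- Integrability is carried through the induction because additivity of the integral over adjacent
  -- intervals needs it.
  suffices H : ∀ j ≤ k, IntervalIntegrable (speed h θ c) volume (s 0) (s j) ∧
      SmoothLink h θ (c (s 0)) (c (s j)) (finslerLength h θ (s 0) (s j) c) from (H k le_rfl).2
  intro j
  induction j with
  | zero =>
    intro _
    refine ⟨IntervalIntegrable.refl, ?_⟩
    rw [finslerLength, intervalIntegral.integral_same]
    exact SmoothLink.refl _
  | succ j ih =>
    intro hj
    obtain ⟨h1, h2⟩ := ih (by omega)
    have h3 := intervalIntegrable_speed (h := h) (θ := θ) (hs j hj) (hsm j hj)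
    refine ⟨h1.trans h3, ?_⟩
    have h4 := h2.trans (SmoothLink.of_contMDiffOn (hs j hj) (hsm j hj))
    have h5 := intervalIntegral.integral_add_adjacent_intervals h1 h3
    change finslerLength h θ _ _ c + finslerLength h θ _ _ c = finslerLength h θ _ _ c at h5
    rwa [h5] at h4

theorem SmoothLink.exists_curve {L : ℝ} (hl : SmoothLink h θ x y L) :
    ∃ (c : ℝ → M), ContMDiff 𝓘(ℝ, ℝ) (𝓡 n) ∞ c ∧ c (-1) = x ∧ c 1 = y ∧
      finslerLength h θ (-1) 1 c = L := by
  obtain ⟨c, hc, hl, hr, rfl⟩ := hl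
  exact ⟨c, hc, hl _ (by norm_num), hr _ le_rfl,
    integral_speed_eq_finslerLength hl hr (by norm_num) le_rfl⟩

variable (h θ) in
-- Points in a chart ball are joined by the preimage of a straight segment.
theorem eventually_smoothLink (x : M) :
    ∃ U ∈ 𝓝 x, ∀ y ∈ U, ∀ z ∈ U, ∃ L, SmoothLink h θ y z L := by
  set φ := extChartAt (𝓡 n) x with hφ
  have hto : φ.target ∈ 𝓝 (φ x) := extChartAt_target_mem_nhds x
  obtain ⟨r, hr, hball⟩ := Metric.mem_nhds_iff.1 hto
  refine ⟨φ.source ∩ φ ⁻¹' Metric.ball (φ x) r, ?_, ?_⟩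
  · exact inter_mem (extChartAt_source_mem_nhds x)
      ((continuousAt_extChartAt x).preimage_mem_nhds (Metric.ball_mem_nhds _ hr))
  · rintro y ⟨hy, hyr⟩ z ⟨hz, hzr⟩
    have hsm : ContMDiffOn 𝓘(ℝ, ℝ) (𝓡 n) ∞
        (φ.symm ∘ fun s : ℝ => φ y + s • (φ z - φ y)) (Icc 0 1) := by
      refine (contMDiffOn_extChartAt_symm x).comp
        (ContDiff.contMDiff (by fun_prop)).contMDiffOn ?_
      intro s hs
      exact hball ((convex_ball (φ x) r).add_smul_sub_mem hyr hzr hs)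
    have := SmoothLink.of_contMDiffOn (h := h) (θ := θ) zero_lt_one hsm
    simp only [Function.comp_apply, zero_smul, add_zero, one_smul, add_sub_cancel,
      φ.left_inv hy, φ.left_inv hz] at this
    exact ⟨_, this⟩

variable (h θ) in
theorem exists_smoothLink [PreconnectedSpace M] (x y : M) : ∃ L, SmoothLink h θ x y L := by
  refine PreconnectedSpace.induction₂' (fun x y => ∃ L, SmoothLink h θ x y L) ?_ ?_ x y
  · intro x
    obtain ⟨U, hU, hlink⟩ := eventually_smoothLink h θ x
    filter_upwards [hU] with y hy
    exact ⟨hlink x (mem_of_mem_nhds hU) y hy, hlink y hy x (mem_of_mem_nhds hU)⟩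
  · exact ⟨fun x y z ⟨L, hL⟩ ⟨L', hL'⟩ => ⟨_, hL.trans hL'⟩⟩

end Links

/-! ### The generalized distance -/

section Distance

theorem PiecewiseSmooth.of_contMDiffOn {n : ℕ} {M : Type*} [TopologicalSpace M]
    [ChartedSpace (EuclideanSpace ℝ (Fin n)) M] {c : ℝ → M} {a b : ℝ} (hab : a < b)
    (hc : ContMDiffOn 𝓘(ℝ, ℝ) (𝓡 n) ∞ c (Icc a b)) : PiecewiseSmooth n a b c := by
  refine ⟨1, fun i => if i = 0 then a else b, by simp, by simp, ?_, ?_⟩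
  · intro i hi
    obtain rfl : i = 0 := by omega
    simpa using hab
  · intro i hi
    obtain rfl : i = 0 := by omega
    simpa using hc

variable {n : ℕ} {M : Type*} [TopologicalSpace M] [ChartedSpace (EuclideanSpace ℝ (Fin n)) M]
  [IsManifold (𝓡 n) ∞ M] {h : RiemMetric n M} {θ : OneForm n M} {c : ℝ → M} {x y z : M}

theorem finslerLength_nonneg {a b : ℝ} (hab : a ≤ b) : 0 ≤ finslerLength h θ a b c :=
  intervalIntegral.integral_nonneg hab fun s _ => speed_nonneg h θ c s

theorem finslerDist_nonneg (x y : M) : 0 ≤ finslerDist h θ x y := by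
  apply Real.sInf_nonneg
  rintro _ ⟨a, b, c, hab, -, -, -, rfl⟩
  exact finslerLength_nonneg hab

theorem finslerDist_le_finslerLength {a b : ℝ} (hab : a ≤ b) (hc : PiecewiseSmooth n a b c) :
    finslerDist h θ (c a) (c b) ≤ finslerLength h θ a b c := by
  refine csInf_le ⟨0, ?_⟩ ⟨a, b, c, hab, hc, rfl, rfl, rfl⟩
  rintro _ ⟨a, b, c, hab, -, -, -, rfl⟩
  exact finslerLength_nonneg hab

theorem SmoothLink.finslerDist_le {L : ℝ} (hl : SmoothLink h θ x y L) :
    finslerDist h θ x y ≤ L := by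
  obtain ⟨c, hc, rfl, rfl, rfl⟩ := hl.exists_curve
  exact finslerDist_le_finslerLength (by norm_num)
    (.of_contMDiffOn (by norm_num) hc.contMDiffOn)

theorem exists_smoothLink_lt [PreconnectedSpace M] {δ : ℝ} (hd : finslerDist h θ x y < δ) :
    ∃ L < δ, SmoothLink h θ x y L := by
  -- Connectedness makes the set of lengths non-empty; otherwise its `sInf` would be the default
  -- value `0`.
  obtain ⟨_, ⟨a, b, c, hab, hc, rfl, rfl, rfl⟩, hlt⟩ := exists_lt_of_csInf_lt (by
    obtain ⟨L, hL⟩ := exists_smoothLink h θ x y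
    obtain ⟨c, hc, rfl, rfl, rfl⟩ := hL.exists_curve
    exact ⟨_, -1, 1, c, by norm_num, .of_contMDiffOn (by norm_num) hc.contMDiffOn,
      rfl, rfl, rfl⟩) hd
  exact ⟨_, hlt, .of_piecewiseSmooth hc⟩

theorem finslerDist_self (x : M) : finslerDist h θ x x = 0 :=
  le_antisymm (SmoothLink.refl x).finslerDist_le (finslerDist_nonneg x x)

theorem finslerDist_triangle [PreconnectedSpace M] (x y z : M) :
    finslerDist h θ x z ≤ finslerDist h θ x y + finslerDist h θ y z := by
  apply le_of_forall_pos_lt_add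
  intro ε hε
  obtain ⟨L₁, h₁, hl₁⟩ := exists_smoothLink_lt
    (show finslerDist h θ x y < finslerDist h θ x y + ε / 2 by linarith)
  obtain ⟨L₂, h₂, hl₂⟩ := exists_smoothLink_lt
    (show finslerDist h θ y z < finslerDist h θ y z + ε / 2 by linarith)
  have := (hl₁.trans hl₂).finslerDist_le
  linarith

theorem finslerDist_lt_integral {a b : ℝ} (hab : a < b)
    (hc : ContMDiffOn 𝓘(ℝ, ℝ) (𝓡 n) ∞ c (Icc a b)) {f : ℝ → ℝ} (hf : ContinuousOn f (Icc a b))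
    (hlt : ∀ s ∈ Icc a b, speedWithin h θ c (Icc a b) s < f s) :
    finslerDist h θ (c a) (c b) < ∫ s in a..b, f s := by
  refine (finslerDist_le_finslerLength hab.le (.of_contMDiffOn hab hc)).trans_lt ?_
  rw [finslerLength_eq_integral_speedWithin hab.le]
  exact intervalIntegral.integral_lt_integral_of_continuousOn_of_le_of_exists_lt hab
    (continuousOn_speedWithin h θ (uniqueDiffOn_Icc hab) hc) hf
    (fun s hs => (hlt s (Ioc_subset_Icc_self hs)).le)
    ⟨a, left_mem_Icc.2 hab.le, hlt a (left_mem_Icc.2 hab.le)⟩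

end Distance

/-! ### Conformal time and its inverse -/

section ConformalTime

theorem contDiff_primitive {f : ℝ → ℝ} (hf : ContDiff ℝ ∞ f) (a : ℝ) :
    ContDiff ℝ ∞ fun t => ∫ s in a..t, f s := by
  have hd := fun t => (hf.continuous.integral_hasStrictDerivAt a t).hasDerivAt
  rw [contDiff_infty_iff_deriv]
  refine ⟨fun t => (hd t).differentiableAt, ?_⟩
  rwa [show deriv (fun t => ∫ s in a..t, f s) = f from funext fun t => (hd t).deriv]

/-- The conformal time `∫₀ᵗ ds/α(s)`. -/
def confTime (α : ℝ → ℝ) (t : ℝ) : ℝ := ∫ s in (0 : ℝ)..t, 1 / α s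

variable {α : ℝ → ℝ}

theorem confTime_one (t : ℝ) : confTime (fun _ => 1) t = t := by
  simp [confTime]

theorem contDiff_one_div (hα : ContDiff ℝ ∞ α) (hpos : ∀ t, 0 < α t) :
    ContDiff ℝ ∞ fun s => 1 / α s :=
  contDiff_const.div hα fun t => (hpos t).ne'

theorem contDiff_confTime (hα : ContDiff ℝ ∞ α) (hpos : ∀ t, 0 < α t) :
    ContDiff ℝ ∞ (confTime α) :=
  contDiff_primitive (contDiff_one_div hα hpos) 0

theorem hasStrictDerivAt_confTime (hα : ContDiff ℝ ∞ α) (hpos : ∀ t, 0 < α t) (t : ℝ) :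
    HasStrictDerivAt (confTime α) (1 / α t) t :=
  (contDiff_one_div hα hpos).continuous.integral_hasStrictDerivAt 0 t

theorem strictMono_confTime (hα : ContDiff ℝ ∞ α) (hpos : ∀ t, 0 < α t) :
    StrictMono (confTime α) := by
  apply strictMono_of_deriv_pos
  intro t
  rw [(hasStrictDerivAt_confTime hα hpos t).hasDerivAt.deriv]
  exact one_div_pos.2 (hpos t)

theorem confTime_sub (hα : ContDiff ℝ ∞ α) (hpos : ∀ t, 0 < α t) (a b : ℝ) :
    confTime α b - confTime α a = ∫ s in a..b, 1 / α s := by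
  have hc := (contDiff_one_div hα hpos).continuous
  exact intervalIntegral.integral_interval_sub_left (hc.intervalIntegrable _ _)
    (hc.intervalIntegrable _ _)

/-- Only the range is treated, since without an upper bound on `α` conformal time need not be
surjective. -/
theorem exists_confTime_inverse (hα : ContDiff ℝ ∞ α) (hpos : ∀ t, 0 < α t) :
    ∃ β : ℝ → ℝ, (∀ t, β (confTime α t) = t) ∧
      ∀ r ∈ range (confTime α), confTime α (β r) = r ∧ ContDiffAt ℝ ∞ β r ∧
        HasDerivAt β (α (β r)) r := by
  have hd := hasStrictDerivAt_confTime hα hpos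
  have hne : ∀ t, 1 / α t ≠ 0 := fun t => (one_div_pos.2 (hpos t)).ne'
  have hemb : IsOpenEmbedding (confTime α) :=
    .of_continuous_injective_isOpenMap (contDiff_confTime hα hpos).continuous
      (strictMono_confTime hα hpos).injective (isOpenMap_of_hasStrictDerivAt hd hne)
  set e := hemb.toOpenPartialHomeomorph (confTime α) with he
  have hleft : ∀ t, e.symm (confTime α t) = t := fun t => e.left_inv (by simp [he])
  refine ⟨e.symm, hleft, ?_⟩
  rintro _ ⟨t, rfl⟩
  have ht : confTime α t ∈ e.target := by simp [he]
  refine ⟨by rw [hleft], ?_, ?_⟩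
  · refine e.contDiffAt_symm_deriv (hne t) ht ?_ ?_
    · rw [hleft]
      exact (hd t).hasDerivAt
    · exact (contDiff_confTime hα hpos).contDiffAt
  · have h1 : HasDerivAt (e : ℝ → ℝ) (1 / α t) (e.symm (confTime α t)) := by
      rw [hleft]
      exact (hd t).hasDerivAt
    have := e.hasDerivAt_symm ht (hne t) h1
    rw [hleft]
    simpa using this

end ConformalTime

/-! ### The chronological relation as a distance inequality -/

section Chronology

variable {n : ℕ} {M : Type*} [TopologicalSpace M] [ChartedSpace (EuclideanSpace ℝ (Fin n)) M]
  [IsManifold (𝓡 n) ∞ M] {h : RiemMetric n M} {θ : OneForm n M} {α : ℝ → ℝ}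
  {hα : ContDiff ℝ ∞ α} {hpos : ∀ t, 0 < α t}

theorem futureTimelike_velocity_iff {τ : ℝ → ℝ} {c : ℝ → M} {S : Set ℝ} {s : ℝ}
    (hS : UniqueDiffWithinAt ℝ S s) {τ' : ℝ} (hτ : HasDerivWithinAt τ τ' S s)
    (hc : MDifferentiableWithinAt 𝓘(ℝ, ℝ) (𝓡 n) c S s) :
    FutureTimelike (warpedMetric h θ α hα hpos) (τ s, c s)
      (mfderivWithin 𝓘(ℝ, ℝ) (prodModel n) (fun r => (τ r, c r)) S s (1 : ℝ)) ↔
      speedWithin h θ c S s < τ' / α (τ s) := by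
  have h1 : HasMFDerivWithinAt 𝓘(ℝ, ℝ) 𝓘(ℝ, ℝ) τ S s
      (ContinuousLinearMap.toSpanSingleton ℝ τ') :=
    hasMFDerivWithinAt_iff_hasFDerivWithinAt.2 hτ.hasFDerivWithinAt
  have h2 := (h1.prodMk hc.hasMFDerivWithinAt).mfderivWithin hS.uniqueMDiffWithinAt
  rw [futureTimelike_warpedMetric_iff, h2]
  change speedWithin h θ c S s < (1 : ℝ) • τ' / α (τ s) ↔ _
  rw [one_smul]

theorem finslerDist_lt_of_chron {p q : ℝ × M} (hpq : Chron (warpedMetric h θ α hα hpos) p q) :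
    finslerDist h θ p.2 q.2 < confTime α q.1 - confTime α p.1 := by
  obtain ⟨a, b, γ, hab, ⟨hγ, ht⟩, rfl, rfl⟩ := hpq
  have hc : ContMDiffOn 𝓘(ℝ, ℝ) (𝓡 n) ∞ (fun s => (γ s).2) (Icc a b) :=
    contMDiff_snd.comp_contMDiffOn hγ
  have hτ : ContDiffOn ℝ ∞ (fun s => (γ s).1) (Icc a b) :=
    contMDiffOn_iff_contDiffOn.1 (contMDiff_fst.comp_contMDiffOn hγ)
  have hu := uniqueDiffOn_Icc hab
  have hd : ∀ s ∈ Icc a b, HasDerivWithinAt (fun s => (γ s).1)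
      (derivWithin (fun s => (γ s).1) (Icc a b) s) (Icc a b) s := fun s hs =>
    (hτ.differentiableOn (by simp) s hs).hasDerivWithinAt
  have hlt : ∀ s ∈ Icc a b, speedWithin h θ (fun s => (γ s).2) (Icc a b) s
      < derivWithin (fun s => (γ s).1) (Icc a b) s / α (γ s).1 := fun s hs =>
    (futureTimelike_velocity_iff (hu s hs) (hd s hs)
      ((hc s hs).mdifferentiableWithinAt (by simp))).1 (ht s hs)
  have hcont : ContinuousOn (fun s => derivWithin (fun s => (γ s).1) (Icc a b) s / α (γ s).1)
      (Icc a b) :=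
    (hτ.continuousOn_derivWithin hu (by simp)).div
      (hα.continuous.comp_continuousOn hτ.continuousOn) fun s _ => (hpos _).ne'
  refine (finslerDist_lt_integral hab hc hcont hlt).trans_eq ?_
  apply intervalIntegral.integral_eq_sub_of_hasDerivAt_of_le hab.le
    (f := fun s => confTime α (γ s).1)
  · exact (contDiff_confTime hα hpos).continuous.comp_continuousOn hτ.continuousOn
  · intro s hs
    have h1 := (hd s (Ioo_subset_Icc_self hs)).hasDerivAt (Icc_mem_nhds hs.1 hs.2)
    have h2 := (hasStrictDerivAt_confTime hα hpos (γ s).1).hasDerivAt.comp s h1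
    rwa [one_div_mul_eq_div] at h2
  · exact hcont.intervalIntegrable_of_Icc hab.le

/-- The Finsler speed is only known to be continuous, while a timelike curve needs a smooth time
component that moves strictly faster and arrives exactly on time. A polynomial within `η` of `f + η`
lies strictly between `f` and `f + 2η`; `η` is chosen so that its integral is at most `δ`, and a
constant `κ ≥ 0` makes up the rest. -/
theorem exists_contDiff_gt_integral_eq {f : ℝ → ℝ} {a b δ : ℝ} (hab : a < b)
    (hf : ContinuousOn f (Icc a b)) (hδ : ∫ s in a..b, f s < δ) :
    ∃ φ : ℝ → ℝ, ContDiff ℝ ∞ φ ∧ (∀ s ∈ Icc a b, f s < φ s) ∧ ∫ s in a..b, φ s = δ := by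
  have hba : 0 < b - a := sub_pos.2 hab
  set η := (δ - ∫ s in a..b, f s) / (2 * (b - a)) with hη
  have hη0 : 0 < η := div_pos (sub_pos.2 hδ) (by linarith)
  have hηe : 2 * (b - a) * η = δ - ∫ s in a..b, f s := by
    rw [hη]
    field_simp
  obtain ⟨p, hp⟩ := exists_polynomial_near_of_continuousOn a b (fun s => f s + η)
    (hf.add continuousOn_const) η hη0
  have hpc : ContDiff ℝ ∞ fun s => p.eval s := by
    simpa using p.contDiff_aeval (𝕜 := ℝ) ∞
  have hfi := hf.intervalIntegrable_of_Icc (μ := volume) hab.le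
  have hpi := hpc.continuous.intervalIntegrable (μ := volume) a b
  have hle : ∫ s in a..b, p.eval s ≤ ∫ s in a..b, (f s + 2 * η) := by
    apply intervalIntegral.integral_mono_on hab.le hpi (hfi.add intervalIntegrable_const)
    intro s hs
    have := (abs_lt.1 (hp s hs)).2
    linarith
  rw [intervalIntegral.integral_add hfi intervalIntegrable_const,
    intervalIntegral.integral_const, smul_eq_mul] at hle
  set κ := (δ - ∫ s in a..b, p.eval s) / (b - a) with hκ
  have hκ0 : 0 ≤ κ := div_nonneg (by linarith) hba.le
  refine ⟨fun s => p.eval s + κ, hpc.add contDiff_const, ?_, ?_⟩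
  · intro s hs
    have := (abs_lt.1 (hp s hs)).1
    linarith
  · rw [intervalIntegral.integral_add hpi intervalIntegrable_const,
      intervalIntegral.integral_const, smul_eq_mul, hκ]
    field_simp
    ring

theorem SmoothLink.chron {x y : M} {L t₀ t₁ : ℝ} (hl : SmoothLink h θ x y L)
    (hL : L < confTime α t₁ - confTime α t₀) :
    Chron (warpedMetric h θ α hα hpos) (t₀, x) (t₁, y) := by
  obtain ⟨c, hc, rfl, rfl, rfl⟩ := hl.exists_curve
  have hab : (-1 : ℝ) < 1 := by norm_num
  have hcS := hc.contMDiffOn (s := Icc (-1) 1)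
  rw [finslerLength_eq_integral_speedWithin hab.le] at hL
  obtain ⟨φ, hφ, hlt, hint⟩ := exists_contDiff_gt_integral_eq hab
    (continuousOn_speedWithin h θ (uniqueDiffOn_Icc hab) hcS) hL
  obtain ⟨β, hβl, hβ⟩ := exists_confTime_inverse hα hpos
  -- `σ` is the conformal time along the lifted curve: its rate `φ` exceeds the speed of `c`, and `β
  -- ∘ σ` converts it back to `t`.
  set σ : ℝ → ℝ := fun r => confTime α t₀ + ∫ s in (-1)..r, φ s with hσ
  have hσs : ContDiff ℝ ∞ σ := contDiff_const.add (contDiff_primitive hφ _)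
  have hσd : ∀ s, HasDerivAt σ (φ s) s := fun s =>
    (hφ.continuous.integral_hasStrictDerivAt (-1) s).hasDerivAt.const_add _
  have hσ₀ : σ (-1) = confTime α t₀ := by simp [hσ]
  have hσ₁ : σ 1 = confTime α t₁ := by simp [hσ, hint]
  have hmono : MonotoneOn σ (Icc (-1) 1) := by
    apply monotoneOn_of_deriv_nonneg (convex_Icc _ _) hσs.continuous.continuousOn
      (hσs.differentiable (by simp)).differentiableOn
    intro s hs
    rw [(hσd s).deriv]
    exact (randers_nonneg h θ _ _).trans (hlt s (interior_subset hs)).le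
  have hrange : ∀ s ∈ Icc (-1 : ℝ) 1, σ s ∈ range (confTime α) := by
    intro s hs
    have h1 := hmono (left_mem_Icc.2 hab.le) hs hs.1
    have h2 := hmono hs (right_mem_Icc.2 hab.le) hs.2
    rw [hσ₀] at h1
    rw [hσ₁] at h2
    exact mem_range_of_exists_le_of_exists_ge (contDiff_confTime hα hpos).continuous
      ⟨t₀, h1⟩ ⟨t₁, h2⟩
  refine ⟨-1, 1, fun s => (β (σ s), c s), hab, ⟨?_, ?_⟩, ?_, ?_⟩
  · refine ContMDiffOn.prodMk ?_ hcS
    exact ContDiffOn.contMDiffOn fun s hs =>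
      ((hβ _ (hrange s hs)).2.1.comp s hσs.contDiffAt).contDiffWithinAt
  · intro s hs
    have hd : HasDerivWithinAt (fun s => β (σ s)) (α (β (σ s)) * φ s) (Icc (-1) 1) s :=
      ((hβ _ (hrange s hs)).2.2.comp s (hσd s)).hasDerivWithinAt
    refine (futureTimelike_velocity_iff (uniqueDiffOn_Icc hab s hs) hd
      ((hcS s hs).mdifferentiableWithinAt (by simp))).2 ?_
    rw [mul_div_cancel_left₀ _ (hpos _).ne']
    exact hlt s hs
  · simp [hσ₀, hβl]
  · simp [hσ₁, hβl]

theorem chron_warpedMetric_iff [PreconnectedSpace M] {p q : ℝ × M} :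
    Chron (warpedMetric h θ α hα hpos) p q ↔
      finslerDist h θ p.2 q.2 < confTime α q.1 - confTime α p.1 := by
  refine ⟨finslerDist_lt_of_chron, fun hd => ?_⟩
  obtain ⟨L, hL, hl⟩ := exists_smoothLink_lt hd
  exact hl.chron hL

theorem chron_closedMetric_iff [PreconnectedSpace M] {p q : ℝ × M} :
    Chron (closedMetric h θ) p q ↔ finslerDist h θ p.2 q.2 < q.1 - p.1 := by
  rw [closedMetric, chron_warpedMetric_iff, confTime_one, confTime_one]

end Chronology

/-! ### Past sets and indecomposability for the closed metric -/

section PastSets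

variable {n : ℕ} {M : Type*} [TopologicalSpace M] [ChartedSpace (EuclideanSpace ℝ (Fin n)) M]
  [IsManifold (𝓡 n) ∞ M]

theorem chronPast_mono {g : SplitMetric n M} {S T : Set (ℝ × M)} (hST : S ⊆ T) :
    chronPast g S ⊆ chronPast g T :=
  fun _ ⟨q, hq, hpq⟩ => ⟨q, hST hq, hpq⟩

variable [PreconnectedSpace M] {h : RiemMetric n M} {θ : OneForm n M} {p q r : ℝ × M}
  {P S : Set (ℝ × M)}

theorem chron_closedMetric_trans (hpq : Chron (closedMetric h θ) p q)
    (hqr : Chron (closedMetric h θ) q r) : Chron (closedMetric h θ) p r := by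
  rw [chron_closedMetric_iff] at *
  linarith [finslerDist_triangle (h := h) (θ := θ) p.2 q.2 r.2]

theorem exists_chron_between (hpq : Chron (closedMetric h θ) p q) :
    ∃ r, Chron (closedMetric h θ) p r ∧ Chron (closedMetric h θ) r q := by
  rw [chron_closedMetric_iff] at hpq
  -- The point lies below `q` on the same vertical line, lowered by half the slack in the
  -- inequality.
  refine ⟨((q.1 + p.1 + finslerDist h θ p.2 q.2) / 2, q.2), ?_, ?_⟩ <;>
    rw [chron_closedMetric_iff]
  · dsimp only
    linarith
  · rw [finslerDist_self]
    dsimp only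
    linarith

theorem not_chron_self (p : ℝ × M) : ¬ Chron (closedMetric h θ) p p := by
  rw [chron_closedMetric_iff, finslerDist_self]
  simp

theorem isPastSet_chronPast (hS : (chronPast (closedMetric h θ) S).Nonempty) :
    IsPastSet (closedMetric h θ) (chronPast (closedMetric h θ) S) := by
  refine ⟨hS, subset_antisymm ?_ ?_⟩
  · rintro p ⟨q, ⟨r, hr, hqr⟩, hpq⟩
    exact ⟨r, hr, chron_closedMetric_trans hpq hqr⟩
  · rintro p ⟨r, hr, hpr⟩
    obtain ⟨q, hpq, hqr⟩ := exists_chron_between hpr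
    exact ⟨q, ⟨r, hr, hqr⟩, hpq⟩

theorem exists_chron_closedMetric (q : ℝ × M) : ∃ p, Chron (closedMetric h θ) p q := by
  refine ⟨(q.1 - 1, q.2), ?_⟩
  rw [chron_closedMetric_iff, finslerDist_self]
  simp

theorem chronPast_nonempty (hS : S.Nonempty) : (chronPast (closedMetric h θ) S).Nonempty := by
  obtain ⟨q, hq⟩ := hS
  obtain ⟨p, hp⟩ := exists_chron_closedMetric (h := h) (θ := θ) q
  exact ⟨p, q, hq, hp⟩

/-- `P` is the union of the pasts of `A = P ∩ I⁺(p)` and `B = P \ I⁺(p)`, so one of these is all of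
`P`. It cannot be the past of `B`, which does not contain `p`; hence `q` lies in the past of `A`. -/
theorem IsIP.directed (hP : IsIP (closedMetric h θ) P) (hp : p ∈ P) (hq : q ∈ P) :
    ∃ r ∈ P, Chron (closedMetric h θ) p r ∧ Chron (closedMetric h θ) q r := by
  obtain ⟨⟨-, hP⟩, hind⟩ := hP
  set A := P ∩ {r | Chron (closedMetric h θ) p r} with hA
  set B := P \ {r | Chron (closedMetric h θ) p r} with hB
  have hAP : chronPast (closedMetric h θ) A ⊆ P := by
    conv_rhs => rw [← hP]
    exact chronPast_mono inter_subset_left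
  have hBP : chronPast (closedMetric h θ) B ⊆ P := by
    conv_rhs => rw [← hP]
    exact chronPast_mono sdiff_subset
  have hAne : A.Nonempty := by
    rw [← hP] at hp
    obtain ⟨r, hr, hpr⟩ := hp
    exact ⟨r, hr, hpr⟩
  have hpB : p ∈ B := ⟨hp, not_chron_self p⟩
  by_cases hAe : chronPast (closedMetric h θ) A = P
  · rw [← hAe] at hq
    obtain ⟨r, hr, hqr⟩ := hq
    exact ⟨r, hr.1, hr.2, hqr⟩
  by_cases hBe : chronPast (closedMetric h θ) B = P
  · rw [← hBe] at hp
    obtain ⟨r, hr, hpr⟩ := hp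
    exact absurd hpr hr.2
  refine absurd ⟨_, _, isPastSet_chronPast (chronPast_nonempty hAne),
    isPastSet_chronPast (chronPast_nonempty ⟨p, hpB⟩), hAP.ssubset_of_ne hAe,
    hBP.ssubset_of_ne hBe, subset_antisymm ?_ (union_subset hAP hBP)⟩ hind
  intro r hr
  rw [← hP] at hr
  obtain ⟨s, hs, hrs⟩ := hr
  by_cases hps : Chron (closedMetric h θ) p s
  · exact Or.inl ⟨s, ⟨hs, hps⟩, hrs⟩
  · exact Or.inr ⟨s, ⟨hs, hps⟩, hrs⟩

end PastSets

/-! ### The difference between conformal time and time -/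

section TimeShift

variable {α : ℝ → ℝ} {Ω : WithTop ℝ} {t : ℝ}

theorem eventually_toEnd (ht : (t : WithTop ℝ) < Ω) :
    ∀ᶠ r in toEnd Ω, t < r ∧ (r : WithTop ℝ) < Ω := by
  induction Ω using WithTop.recTopCoe with
  | top => exact (eventually_gt_atTop t).mono fun r hr => ⟨hr, WithTop.coe_lt_top r⟩
  | coe R =>
    have hR : t < R := WithTop.coe_lt_coe.1 ht
    change ∀ᶠ r in 𝓝[<] R, _
    filter_upwards [Ioo_mem_nhdsLT hR] with r hr
    exact ⟨hr.1, WithTop.coe_lt_coe.2 hr.2⟩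

instance toEnd_neBot : (toEnd Ω).NeBot := by
  induction Ω using WithTop.recTopCoe with
  | top => exact atTop_neBot
  | coe R => exact nhdsLT_neBot R

theorem confTime_sub_self (hα : ContDiff ℝ ∞ α) (hpos : ∀ t, 0 < α t) (t : ℝ) :
    confTime α t - t = ∫ s in (0 : ℝ)..t, (1 / α s - 1) := by
  rw [intervalIntegral.integral_sub
    ((contDiff_one_div hα hpos).continuous.intervalIntegrable _ _) intervalIntegrable_const]
  simp [confTime]

theorem tendsto_confTime_sub_self (hα : ContDiff ℝ ∞ α) (hpos : ∀ t, 0 < α t)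
    (hint : IntegrableOn (fun s => 1 / α s - 1) (Ioi (0 : ℝ))) (Ω : WithTop ℝ) :
    Tendsto (fun t => confTime α t - t) (toEnd Ω) (𝓝 (shiftConst α Ω)) := by
  induction Ω using WithTop.recTopCoe with
  | top =>
    simp_rw [confTime_sub_self hα hpos]
    change Tendsto _ atTop _
    exact intervalIntegral_tendsto_integral_Ioi 0 hint tendsto_id
  | coe R =>
    have hc : Continuous fun t => confTime α t - t :=
      (contDiff_confTime hα hpos).continuous.sub continuous_id
    have hR : shiftConst α (R : WithTop ℝ) = confTime α R - R :=
      (confTime_sub_self hα hpos R).symm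
    rw [hR]
    exact (hc.tendsto R).mono_left nhdsWithin_le_nhds

theorem monotone_confTime_sub_self (hα : ContDiff ℝ ∞ α) (hpos : ∀ t, 0 < α t)
    (hle : ∀ t, α t ≤ 1) : Monotone fun t => confTime α t - t := by
  have hd : ∀ t, HasDerivAt (fun t => confTime α t - t) (1 / α t - 1) t := fun t =>
    (hasStrictDerivAt_confTime hα hpos t).hasDerivAt.sub (hasDerivAt_id t)
  apply monotone_of_deriv_nonneg fun t => (hd t).differentiableAt
  intro t
  rw [(hd t).deriv, sub_nonneg, le_div_iff₀ (hpos t), one_mul]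
  exact hle t

theorem bddAbove_range_confTime_sub_self (hα : ContDiff ℝ ∞ α) (hpos : ∀ t, 0 < α t)
    (hle : ∀ t, α t ≤ 1) (hint : IntegrableOn (fun s => 1 / α s - 1) (Ioi (0 : ℝ))) :
    BddAbove (range fun t => confTime α t - t) := by
  refine ⟨shiftConst α ⊤, ?_⟩
  rintro _ ⟨t, rfl⟩
  exact (monotone_confTime_sub_self hα hpos hle).ge_of_tendsto
    (tendsto_confTime_sub_self hα hpos hint ⊤) t

theorem bddAbove_image_confTime_sub_self (hα : ContDiff ℝ ∞ α) (hpos : ∀ t, 0 < α t)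
    (hle : ∀ t, α t ≤ 1) (hint : IntegrableOn (fun s => 1 / α s - 1) (Ioi (0 : ℝ)))
    {M : Type*} (P : Set (ℝ × M)) :
    BddAbove ((fun p : ℝ × M => confTime α p.1 - p.1) '' P) := by
  refine (bddAbove_range_confTime_sub_self hα hpos hle hint).mono ?_
  rintro _ ⟨v, -, rfl⟩
  exact ⟨v.1, rfl⟩

/-- Conformal time is at least `w` at `w ≥ 0` and at most `w` at `w ≤ 0`, so it is unbounded both
ways. -/
theorem surjective_confTime (hα : ContDiff ℝ ∞ α) (hpos : ∀ t, 0 < α t)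
    (hle : ∀ t, α t ≤ 1) : Function.Surjective (confTime α) := by
  intro w
  have h0 : confTime α 0 = 0 := intervalIntegral.integral_same
  have hmono := monotone_confTime_sub_self hα hpos hle
  have h1 := hmono (min_le_right w 0)
  have h2 := hmono (le_max_right w 0)
  simp only [h0, sub_zero] at h1 h2
  exact mem_range_of_exists_le_of_exists_ge (contDiff_confTime hα hpos).continuous
    ⟨min w 0, by linarith [min_le_left w 0]⟩ ⟨max w 0, by linarith [le_max_left w 0]⟩

end TimeShift

/-! ### Busemann functions and pasts of graphs -/

section Busemann

variable {n : ℕ} {M : Type*} [TopologicalSpace M] [ChartedSpace (EuclideanSpace ℝ (Fin n)) M]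
  [IsManifold (𝓡 n) ∞ M] {h : RiemMetric n M} {θ : OneForm n M} {α : ℝ → ℝ}
  {a : ℝ} {Ω : WithTop ℝ} {c : ℝ → M} {b : M → ℝ}

theorem IsBusemannCurve.finslerDist_lt (hα : ContDiff ℝ ∞ α) (hpos : ∀ t, 0 < α t)
    (hc : IsBusemannCurve h θ α a Ω c) {t t' : ℝ} (hat : a ≤ t) (htt : t < t')
    (ht' : (t' : WithTop ℝ) < Ω) :
    finslerDist h θ (c t) (c t') < confTime α t' - confTime α t := by
  obtain ⟨-, hsm, hlt⟩ := hc
  have hsub : Icc t t' ⊆ timeInterval a Ω := fun s hs =>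
    ⟨hat.trans hs.1, (WithTop.coe_le_coe.2 hs.2).trans_lt ht'⟩
  rw [confTime_sub hα hpos]
  apply finslerDist_lt_integral htt (hsm.mono hsub)
    (contDiff_one_div hα hpos).continuous.continuousOn
  intro s hs
  rw [speedWithin, mfderivWithin_subset hsub (uniqueDiffOn_Icc htt s hs).uniqueMDiffWithinAt
    ((hsm s (hsub hs)).mdifferentiableWithinAt (by simp))]
  exact hlt s (hsub hs)

/-- The graph `{(t, c(t)) | t ∈ [a, Ω)}`. -/
def timeGraph (a : ℝ) (Ω : WithTop ℝ) (c : ℝ → M) : Set (ℝ × M) :=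
  (fun t => (t, c t)) '' timeInterval a Ω

theorem pastOf_eq_chronPast [PreconnectedSpace M] (hα : ContDiff ℝ ∞ α) (hpos : ∀ t, 0 < α t)
    (hc : IsBusemannCurve h θ α a Ω c) (hb : IsBusemannOf h θ α Ω c b) :
    pastOf α b = chronPast (warpedMetric h θ α hα hpos) (timeGraph a Ω c) := by
  ext ⟨t₀, x₀⟩
  change confTime α t₀ < b x₀ ↔ _
  have hb : Tendsto (fun t => confTime α t - finslerDist h θ x₀ (c t)) (toEnd Ω) (𝓝 (b x₀)) :=
    hb x₀
  constructor
  · intro hlt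
    obtain ⟨t, ht, hat, htΩ⟩ := ((hb.eventually_const_lt hlt).and (eventually_toEnd hc.1)).exists
    refine ⟨_, ⟨t, ⟨hat.le, htΩ⟩, rfl⟩, ?_⟩
    rw [chron_warpedMetric_iff]
    dsimp only
    linarith
  · rintro ⟨_, ⟨t, ⟨hat, htΩ⟩, rfl⟩, hch⟩
    rw [chron_warpedMetric_iff] at hch
    refine lt_of_lt_of_le (b := confTime α t - finslerDist h θ x₀ (c t)) ?_ ?_
    · dsimp only at hch
      linarith
    -- By the triangle inequality through `c t`, the function whose limit is `b x₀` does not fall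
    -- below its value at `t` afterwards.
    · apply ge_of_tendsto hb
      filter_upwards [eventually_toEnd htΩ] with r hr
      have h1 := hc.finslerDist_lt hα hpos hat hr.1 hr.2
      have h2 := finslerDist_triangle (h := h) (θ := θ) x₀ (c t) (c r)
      linarith

theorem IsBusemannCurve.of_conesWiden {hα : ContDiff ℝ ∞ α} {hpos : ∀ t, 0 < α t}
    (hw : ConesWiden (closedMetric h θ) (warpedMetric h θ α hα hpos))
    (hc : IsBusemannCurve h θ (fun _ => 1) a Ω c) : IsBusemannCurve h θ α a Ω c := by
  refine ⟨hc.1, hc.2.1, fun t ht => ?_⟩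
  apply randers_lt_div_of_conesWiden hw
  have := hc.2.2 t ht
  rwa [div_one] at this

theorem IsBusemannOf.add_shiftConst (hα : ContDiff ℝ ∞ α) (hpos : ∀ t, 0 < α t)
    (hint : IntegrableOn (fun s => 1 / α s - 1) (Ioi (0 : ℝ)))
    (hb : IsBusemannOf h θ (fun _ => 1) Ω c b) :
    IsBusemannOf h θ α Ω c (fun x => b x + shiftConst α Ω) := by
  intro x
  refine ((hb x).add (tendsto_confTime_sub_self hα hpos hint Ω)).congr fun t => ?_
  change confTime (fun _ => 1) t - _ + _ = confTime α t - _
  rw [confTime_one]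
  ring

theorem chronPast_chronPast_timeGraph [PreconnectedSpace M] {hα : ContDiff ℝ ∞ α}
    {hpos : ∀ t, 0 < α t}
    (hw : ConesWiden (closedMetric h θ) (warpedMetric h θ α hα hpos))
    (hc : IsBusemannCurve h θ (fun _ => 1) a Ω c) :
    chronPast (warpedMetric h θ α hα hpos) (chronPast (closedMetric h θ) (timeGraph a Ω c))
      = chronPast (warpedMetric h θ α hα hpos) (timeGraph a Ω c) := by
  apply subset_antisymm
  · rintro p ⟨q, ⟨r, hr, hqr⟩, hpq⟩
    refine ⟨r, hr, ?_⟩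
    have hqr := chron_mono_of_conesWiden hw hqr
    rw [chron_warpedMetric_iff] at *
    linarith [finslerDist_triangle (h := h) (θ := θ) p.2 q.2 r.2]
  · rintro p ⟨_, ⟨t, ht, rfl⟩, hpt⟩
    -- The graph has no last point and is itself a `g_cl`-chain, so `(t, c t)` already lies in its
    -- `g_cl`-past.
    obtain ⟨t', htt, ht'⟩ := (eventually_toEnd ht.2).exists
    refine ⟨_, ⟨_, ⟨t', ⟨ht.1.trans htt.le, ht'⟩, rfl⟩, ?_⟩, hpt⟩
    rw [closedMetric, chron_warpedMetric_iff]
    exact hc.finslerDist_lt contDiff_const (fun _ => one_pos) ht.1 htt ht'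

end Busemann

/-! ### Injectivity of the map on indecomposable pasts -/

section Injectivity

variable {n : ℕ} {M : Type*} [TopologicalSpace M] [ChartedSpace (EuclideanSpace ℝ (Fin n)) M]
  [IsManifold (𝓡 n) ∞ M] [PreconnectedSpace M] {h : RiemMetric n M} {θ : OneForm n M}
  {α : ℝ → ℝ} {hα : ContDiff ℝ ∞ α} {hpos : ∀ t, 0 < α t} {P₁ P₂ : Set (ℝ × M)}

theorem finslerDist_eq_zero (hv : ∀ (x : M) (v : TangentSpace (𝓡 n) x), v = 0) (x y : M) :
    finslerDist h θ x y = 0 := by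
  obtain ⟨_, c, hc, hl, hr, rfl⟩ := exists_smoothLink h θ x y
  have hle := SmoothLink.finslerDist_le (h := h) (θ := θ) ⟨c, hc, hl, hr, rfl⟩
  have h0 : speed h θ c = fun _ => 0 := funext fun s => by
    rw [speed, hv _ (mfderiv 𝓘(ℝ, ℝ) (𝓡 n) c s (1 : ℝ)), randers_zero]
  rw [h0, integral_zero] at hle
  exact le_antisymm hle (finslerDist_nonneg x y)

theorem chronPast_warpedMetric_eq (hv : ∀ (x : M) (v : TangentSpace (𝓡 n) x), v = 0)
    (S : Set (ℝ × M)) :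
    chronPast (warpedMetric h θ α hα hpos) S = chronPast (closedMetric h θ) S := by
  ext p
  refine exists_congr fun q => and_congr_right fun _ => ?_
  rw [chron_warpedMetric_iff, chron_closedMetric_iff, finslerDist_eq_zero hv, sub_pos, sub_pos,
    (strictMono_confTime hα hpos).lt_iff_lt]

theorem IsIP.subset_of_chronPast_subset (hle : ∀ t, α t ≤ 1)
    (hint : IntegrableOn (fun s => 1 / α s - 1) (Ioi (0 : ℝ)))
    (h₁ : IsPastSet (closedMetric h θ) P₁) (h₂ : IsIP (closedMetric h θ) P₂)
    (hsup : sSup ((fun p : ℝ × M => confTime α p.1 - p.1) '' P₁)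
      ≤ sSup ((fun p : ℝ × M => confTime α p.1 - p.1) '' P₂))
    (hsub : chronPast (warpedMetric h θ α hα hpos) P₂
      ⊆ chronPast (warpedMetric h θ α hα hpos) P₁) : P₂ ⊆ P₁ := by
  rintro p hp
  rw [← h₂.1.2] at hp
  obtain ⟨q, hq, hpq⟩ := hp
  rw [chron_closedMetric_iff] at hpq
  set ε := q.1 - p.1 - finslerDist h θ p.2 q.2 with hε
  have hε0 : 0 < ε := by linarith
  -- The slack `ε` of `p ≪ q` pays for two errors of `ε/2`: `q'` nearly attains the supremum `C₂`,
  -- and the point `(s, p.2)` below lies just inside the `g_op`-past of `r`. Directedness puts `r`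
  -- above both `q` and `q'`.
  obtain ⟨_, ⟨q', hq', rfl⟩, hlt⟩ := exists_lt_of_lt_csSup (h₂.1.1.image _)
    (sub_lt_self (sSup ((fun p : ℝ × M => confTime α p.1 - p.1) '' P₂)) (half_pos hε0))
  obtain ⟨r, hr, hqr, hqr'⟩ := h₂.directed hq hq'
  rw [chron_closedMetric_iff] at hqr hqr'
  obtain ⟨s, hs⟩ := surjective_confTime hα hpos hle
    (confTime α r.1 - finslerDist h θ p.2 r.2 - ε / 2)
  obtain ⟨u, hu, hsu⟩ := hsub (show (s, p.2) ∈ _ from ⟨r, hr, by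
    rw [chron_warpedMetric_iff, hs]
    dsimp only
    linarith⟩)
  rw [chron_warpedMetric_iff] at hsu
  rw [← h₁.2]
  refine ⟨u, hu, ?_⟩
  rw [chron_closedMetric_iff]
  have hC₁ := le_csSup (bddAbove_image_confTime_sub_self hα hpos hle hint P₁)
    (mem_image_of_mem _ hu)
  have hC₂ := monotone_confTime_sub_self hα hpos hle
    (show q'.1 ≤ r.1 by linarith [finslerDist_nonneg (h := h) (θ := θ) q'.2 r.2])
  have htri := finslerDist_triangle (h := h) (θ := θ) p.2 q.2 r.2
  dsimp only at hsu hC₁ hC₂ hlt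
  -- Write `T` for `confTime α`. From `T(u) ≤ u + C₂` and `T(r) > r + C₂ - ε/2` follows `d⁺(p, u) <
  -- T(u) - T(s) < u - r + d⁺(p, r) + ε`; with `d⁺(p, r) ≤ d⁺(p, q) + d⁺(q, r)` and `d⁺(q, r) < r -
  -- q` this is below `u - p`.
  linarith

theorem IsIP.eq_of_chronPast_eq
    (hw : ConesWiden (closedMetric h θ) (warpedMetric h θ α hα hpos))
    (hint : IntegrableOn (fun s => 1 / α s - 1) (Ioi (0 : ℝ)))
    (h₁ : IsIP (closedMetric h θ) P₁) (h₂ : IsIP (closedMetric h θ) P₂)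
    (heq : chronPast (warpedMetric h θ α hα hpos) P₁
      = chronPast (warpedMetric h θ α hα hpos) P₂) : P₁ = P₂ := by
  by_cases hv : ∀ (x : M) (v : TangentSpace (𝓡 n) x), v = 0
  · rwa [chronPast_warpedMetric_eq hv, chronPast_warpedMetric_eq hv, h₁.1.2, h₂.1.2] at heq
  push Not at hv
  obtain ⟨x, v, hv⟩ := hv
  have hle := le_one_of_conesWiden hv hw
  wlog hsup : sSup ((fun p : ℝ × M => confTime α p.1 - p.1) '' P₁)
      ≤ sSup ((fun p : ℝ × M => confTime α p.1 - p.1) '' P₂) generalizing P₁ P₂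
  · exact (this h₂ h₁ heq.symm (le_of_not_ge hsup)).symm
  have hsub := h₂.subset_of_chronPast_subset hle hint h₁.1 hsup heq.ge
  -- The inclusion just obtained reverses the comparison of suprema, so the same lemma applies with
  -- the roles exchanged.
  have hsup' := csSup_le_csSup (bddAbove_image_confTime_sub_self hα hpos hle hint P₁)
    (h₂.1.1.image _) (image_mono (f := fun p : ℝ × M => confTime α p.1 - p.1) hsub)
  exact subset_antisymm (h₁.subset_of_chronPast_subset hle hint h₂.1 hsup' heq.le) hsub

end Injectivity

end Isocausal

end

/-! ### The main theorem -/

theorem mainTheorem9 {n : ℕ} {M : Type*} [TopologicalSpace M]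
    [ChartedSpace (EuclideanSpace ℝ (Fin n)) M] [IsManifold (𝓡 n) ∞ M]
    [T2Space M] [SecondCountableTopology M] [ConnectedSpace M]
    (h : Isocausal.RiemMetric n M) (θ : Isocausal.OneForm n M)
    (α : ℝ → ℝ) (hα : ContDiff ℝ ∞ α) (hpos : ∀ t, 0 < α t)
    (g : Isocausal.SplitMetric n M)
    (hcl : Isocausal.ConesWiden (Isocausal.closedMetric h θ) g)
    (hop : Isocausal.ConesWiden g (Isocausal.warpedMetric h θ α hα hpos))
    (hint : IntegrableOn (fun s => 1 / α s - 1) (Ioi (0 : ℝ))) :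
    (∀ (a : ℝ) (Ω : WithTop ℝ) (c : ℝ → M) (b : M → ℝ),
      Isocausal.IsBusemannCurve h θ (fun _ => 1) a Ω c →
      Isocausal.IsBusemannOf h θ (fun _ => 1) Ω c b →
        (fun x => b x + Isocausal.shiftConst α Ω) ∈ Isocausal.busemannFunctions h θ α ∧
        Isocausal.chronPast (Isocausal.warpedMetric h θ α hα hpos)
            (Isocausal.pastOf (fun _ => 1) b)
          = Isocausal.pastOf α (fun x => b x + Isocausal.shiftConst α Ω)) ∧
    (∀ P₁ P₂ : Set (ℝ × M),
      Isocausal.IsIP (Isocausal.closedMetric h θ) P₁ →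
      Isocausal.IsIP (Isocausal.closedMetric h θ) P₂ →
        (P₁ ⊂ P₂ →
          Isocausal.chronPast (Isocausal.warpedMetric h θ α hα hpos) P₁
            ⊂ Isocausal.chronPast (Isocausal.warpedMetric h θ α hα hpos) P₂) ∧
        (P₁ ≠ P₂ →
          Isocausal.chronPast (Isocausal.warpedMetric h θ α hα hpos) P₁
            ≠ Isocausal.chronPast (Isocausal.warpedMetric h θ α hα hpos) P₂)) := by
  have hw : Isocausal.ConesWiden (Isocausal.closedMetric h θ)
      (Isocausal.warpedMetric h θ α hα hpos) := fun p u hu => hop p u (hcl p u hu)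
  refine ⟨fun a Ω c b hc hb => ?_, fun P₁ P₂ h₁ h₂ => ?_⟩
  · have hc' := hc.of_conesWiden hw
    have hb' := hb.add_shiftConst hα hpos hint
    refine ⟨⟨a, Ω, c, hc', hb'⟩, ?_⟩
    rw [Isocausal.pastOf_eq_chronPast hα hpos hc' hb',
      Isocausal.pastOf_eq_chronPast contDiff_const (fun _ => one_pos) hc hb]
    exact Isocausal.chronPast_chronPast_timeGraph hw hc
  · have hne := fun (hP : P₁ ≠ P₂) heq => hP (h₁.eq_of_chronPast_eq hw hint h₂ heq)
    exact ⟨fun hP => (Isocausal.chronPast_mono hP.subset).ssubset_of_ne (hne hP.ne), hne⟩
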